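/- 3SAT is polynomial-time (many-one) reducible to the problem EntrQueryDec; that is, there is a function $f$, computable by a Turing machine in time polynomial in the length of its input, that maps every 3SAT formula $R$ to an instance $f(R)$ of EntrQueryDec such that $R$ is satisfiable if and only if $f(R)$ is a yes-instance. Here EntrQueryDec is the following problem. Let $\Omega=\{0,1\}^K$ be the sample space of $K$ attributes $a_1,\dots,a_K$. An itemset is a subset $B$ of the set of attributes, and its frequency under a probability distribution $p$ on $\Omega$ is $p(B=1)$, the probability that all attributes in $B$ equal $1$. An instance consists of the number $K$, a family $\mathcal F=\{B_1,\dots,B_N\}$ of itemsets that is antimonotonic (all subsets of any member are members), a vector $\theta\in\mathbb Q^N$ of frequencies that is consistent (some distribution $p$ on $\Omega$ satisfies it, i.e. $p(B_i=1)=\theta_i$ for all $i$), a query itemset $B$, and a threshold $b\in\mathbb Q$. It is a yes-instance if and only if $f^*>b$, where $f^*$ is the frequency of $B$ under the distribution that maximises the entropy $-\sum_{\omega\in\Omega}p(\omega)\log p(\omega)$ (with $0\log 0=0$) among all distributions on $\Omega$ satisfying the frequencies $\theta$. Itemsets are given by their characteristic vectors and rational numbers by numerator and denominator in binary; a 3SAT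 formula is given by its number of variables, in unary, and the list of its clauses of three literals. -/

import Mathlib

namespace ItemsetQuery

open Computability

/-! ### Decision problems and polynomial-time reductions -/

/-- A decision problem: a type of instances, an injective encoding of the instances as words over a
finite alphabet, and the set of yes-instances. -/
structure DecisionProblem where
  /-- the instances -/
  Instance : Type
  /-- the alphabet -/
  Symbol : Type
  /-- the alphabet is finite -/
  finite_symbol : Finite Symbol
  /-- the word that represents an instance -/
  encode : Instance → List Symbol
  /-- a word represents at most one instance -/
  encode_injective : Function.Injective encode
  /-- the yes-instances -/
  yes : Set Instance

/-- Polynomial-time (many-one) reducibility: some function from the instances of `P` to the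
instances of `Q` preserves the answer and is computed by a (multi-stack) Turing machine in a number
of steps that is polynomial in the length of the encoded instance of `P`. -/
def PolyTimeReducible (P Q : DecisionProblem) : Prop :=
  ∃ f : P.Instance → Q.Instance,
    Nonempty (Turing.TM2ComputableInPolyTime P.encode Q.encode f) ∧
      ∀ x, x ∈ P.yes ↔ f x ∈ Q.yes

/-- Two words that are cut at their first comma agree before and after it. -/
theorem split_comma {a b r s : List Γ'} (ha : Γ'.comma ∉ a) (hb : Γ'.comma ∉ b)
    (h : a ++ Γ'.comma :: r = b ++ Γ'.comma :: s) : a = b ∧ r = s := by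
  induction a generalizing b with
  | nil =>
    cases b with
    | nil => simpa using h
    | cons y b => simp at h hb; exact absurd h.1 hb.1
  | cons x a ih =>
    cases b with
    | nil => simp at h ha; exact absurd h.1.symm ha.1
    | cons y b =>
      simp only [List.cons_append, List.cons.injEq] at h
      simp only [List.mem_cons, not_or] at ha hb
      obtain ⟨h1, h2⟩ := ih ha.2 hb.2 h.2
      exact ⟨by rw [h.1, h1], h2⟩

/-! ### 3SAT -/

/-- A literal over `n` variables: `(v, true)` is the variable `v`, `(v, false)` its negation. -/
abbrev Literal (n : ℕ) : Type := Fin n × Bool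

/-- A formula in conjunctive normal form with three literals in each clause. The literals of a
clause may repeat, which gives the clauses with fewer than three distinct literals. -/
structure ThreeCNF where
  /-- the number of variables -/
  numVars : ℕ
  /-- the clauses -/
  clauses : List (Literal numVars × Literal numVars × Literal numVars)

/-- The truth assignment `t` makes the literal `l` true. -/
def Literal.Holds {n : ℕ} (t : Fin n → Bool) (l : Literal n) : Prop := t l.1 = l.2

/-- Some truth assignment makes a literal true in every clause. -/
def ThreeCNF.Satisfiable (φ : ThreeCNF) : Prop :=
  ∃ t : Fin φ.numVars → Bool, ∀ c ∈ φ.clauses,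
    Literal.Holds t c.1 ∨ Literal.Holds t c.2.1 ∨ Literal.Holds t c.2.2

/-- A literal is written as its sign followed by the index of its variable. The index is in unary;
it is less than the number of variables, which counts in the size of a formula. -/
def encodeLiteral {n : ℕ} (l : Literal n) : List Γ' :=
  Γ'.bit l.2 :: List.replicate l.1.val Γ'.blank ++ [Γ'.comma]

/-- A clause is written as its three literals. -/
def encodeClause {n : ℕ} (c : Literal n × Literal n × Literal n) : List Γ' :=
  encodeLiteral c.1 ++ encodeLiteral c.2.1 ++ encodeLiteral c.2.2

/-- A formula is written as its number of variables, in unary, followed by its clauses. -/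
def ThreeCNF.encode (φ : ThreeCNF) : List Γ' :=
  List.replicate φ.numVars Γ'.blank ++ Γ'.comma :: φ.clauses.flatMap encodeClause

theorem encodeLiteral_append_inj {n : ℕ} {l m : Literal n} {r s : List Γ'}
    (h : encodeLiteral l ++ r = encodeLiteral m ++ s) : l = m ∧ r = s := by
  simp only [encodeLiteral, List.cons_append, List.append_assoc, List.nil_append,
    List.cons.injEq, Γ'.bit.injEq] at h
  obtain ⟨h1, h2⟩ := split_comma (by simp) (by simp) h.2
  have h3 := congrArg List.length h1
  simp only [List.length_replicate] at h3
  exact ⟨Prod.ext (Fin.ext h3) h.1, h2⟩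

theorem encodeClauses_injective {n : ℕ} :
    Function.Injective (fun c : List (Literal n × Literal n × Literal n) =>
      c.flatMap encodeClause) := by
  intro c
  induction c with
  | nil =>
    rintro (_ | ⟨y, d⟩) h
    · rfl
    · simp [encodeClause, encodeLiteral] at h
  | cons x c ih =>
    rintro (_ | ⟨y, d⟩) h
    · simp [encodeClause, encodeLiteral] at h
    · simp only [List.flatMap_cons, encodeClause, List.append_assoc] at h
      obtain ⟨h1, h⟩ := encodeLiteral_append_inj h
      obtain ⟨h2, h⟩ := encodeLiteral_append_inj h
      obtain ⟨h3, h⟩ := encodeLiteral_append_inj h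
      rw [ih h, Prod.ext h1 (Prod.ext h2 h3)]

theorem ThreeCNF.encode_injective : Function.Injective ThreeCNF.encode := by
  rintro ⟨n, c⟩ ⟨m, d⟩ h
  obtain ⟨h1, h2⟩ := split_comma (by simp) (by simp) h
  have h3 := congrArg List.length h1
  simp only [List.length_replicate] at h3
  subst h3
  cases encodeClauses_injective h2
  rfl

/-- The problem 3SAT. -/
def ThreeSAT : DecisionProblem where
  Instance := ThreeCNF
  Symbol := Γ'
  finite_symbol := inferInstance
  encode := ThreeCNF.encode
  encode_injective := ThreeCNF.encode_injective
  yes := {φ | φ.Satisfiable}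

/-! ### Itemsets, frequencies and entropy

The items are the elements of `Fin K`, an itemset is a finset of items, the sample space is
`Fin K → Bool`, and a distribution is an element of the standard simplex over the sample space. -/

/-- The frequency `p (B = 1)` of the itemset `B`: the probability that all items of `B` are one. -/
def frequency {K : ℕ} (p : (Fin K → Bool) → ℝ) (B : Finset (Fin K)) : ℝ :=
  ∑ ω : Fin K → Bool with ∀ i ∈ B, ω i = true, p ω

/-- The entropy `-∑ p(ω) log p(ω)`, with `0 log 0 = 0`. -/
noncomputable def entropy {K : ℕ} (p : (Fin K → Bool) → ℝ) : ℝ :=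
  ∑ ω : Fin K → Bool, Real.negMulLog (p ω)

/-- The distributions that satisfy the given frequencies; the list pairs every itemset of the
family with its frequency. -/
def satisfying {K : ℕ} (F : List (Finset (Fin K) × ℚ)) : Set ((Fin K → Bool) → ℝ) :=
  {p | p ∈ stdSimplex ℝ (Fin K → Bool) ∧ ∀ B ∈ F, frequency p B.1 = (B.2 : ℝ)}

/-- `p` satisfies the given frequencies and maximizes the entropy among the distributions that
do. -/
def IsMaxEntropy {K : ℕ} (F : List (Finset (Fin K) × ℚ)) (p : (Fin K → Bool) → ℝ) : Prop :=
  p ∈ satisfying F ∧ ∀ q ∈ satisfying F, entropy q ≤ entropy p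

/-! ### The maximum entropy query problem -/

/-- An instance of the maximum entropy query problem: an antimonotonic family of itemsets with
rational and consistent frequencies, a query itemset and a rational threshold. -/
structure EntrQueryInstance where
  /-- the number of items -/
  K : ℕ
  /-- the itemsets of the family, each with its frequency -/
  family : List (Finset (Fin K) × ℚ)
  /-- every member of the family is listed once -/
  nodup : (family.map Prod.fst).Nodup
  /-- the family is antimonotonic: all subsets of any member are members -/
  antimonotonic : ∀ B ∈ family.map Prod.fst, ∀ C ⊆ B, C ∈ family.map Prod.fst
  /-- the frequencies are consistent: some distribution satisfies them -/
  consistent : (satisfying family).Nonempty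
  /-- the query -/
  query : Finset (Fin K)
  /-- the threshold -/
  threshold : ℚ

/-- An itemset is written as its characteristic vector, which has length `K`. -/
def encodeItemset {K : ℕ} (B : Finset (Fin K)) : List Γ' :=
  List.ofFn fun i : Fin K => Γ'.bit (decide (i ∈ B))

/-- A rational is written as its sign and its numerator and denominator (in lowest terms) in
binary. -/
def encodeRat (x : ℚ) : List Γ' :=
  Γ'.bit (decide (x < 0)) :: (encodeNat x.num.natAbs).map Γ'.bit ++
    Γ'.comma :: (encodeNat x.den).map Γ'.bit ++ [Γ'.comma]

/-- An itemset is written in front of a rational. -/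
def encodePair {K : ℕ} (B : Finset (Fin K) × ℚ) : List Γ' :=
  encodeItemset B.1 ++ Γ'.comma :: encodeRat B.2

/-- An instance is written as the query with the threshold, followed by the members of the family
with their frequencies. -/
def EntrQueryInstance.encode (I : EntrQueryInstance) : List Γ' :=
  encodePair (I.query, I.threshold) ++ I.family.flatMap encodePair

theorem comma_notMem_encodeItemset {K : ℕ} (B : Finset (Fin K)) :
    Γ'.comma ∉ encodeItemset B := by
  simp [encodeItemset, List.mem_ofFn]

theorem encodeItemset_injective {K : ℕ} :
    Function.Injective (encodeItemset : Finset (Fin K) → List Γ') := by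
  intro B C h
  have h1 := List.ofFn_injective h
  ext i
  have h2 := congrFun h1 i
  simpa using h2

theorem encodeNat_map_bit_injective {a b : ℕ}
    (h : (encodeNat a).map Γ'.bit = (encodeNat b).map Γ'.bit) : a = b := by
  have h1 : encodeNat a = encodeNat b :=
    List.map_injective_iff.2 (fun x y h => by simpa using h) h
  rw [← decode_encodeNat a, h1, decode_encodeNat]

theorem encodeRat_append_inj {x y : ℚ} {r s : List Γ'}
    (h : encodeRat x ++ r = encodeRat y ++ s) : x = y ∧ r = s := by
  simp only [encodeRat, List.cons_append, List.append_assoc, List.nil_append,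
    List.cons.injEq, Γ'.bit.injEq] at h
  obtain ⟨h0, h⟩ := h
  obtain ⟨h1, h⟩ := split_comma (by simp) (by simp) h
  obtain ⟨h2, h⟩ := split_comma (by simp) (by simp) h
  have h1 := encodeNat_map_bit_injective h1
  have h2 := encodeNat_map_bit_injective h2
  have h0 : x.num < 0 ↔ y.num < 0 := by
    rw [Rat.num_neg, Rat.num_neg]; simpa using h0
  exact ⟨Rat.ext (by omega) h2, h⟩

theorem encodePair_append_inj {K : ℕ} {B C : Finset (Fin K) × ℚ} {r s : List Γ'}
    (h : encodePair B ++ r = encodePair C ++ s) : B = C ∧ r = s := by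
  simp only [encodePair, List.cons_append, List.append_assoc] at h
  obtain ⟨h1, h⟩ := split_comma (comma_notMem_encodeItemset _) (comma_notMem_encodeItemset _) h
  obtain ⟨h2, h⟩ := encodeRat_append_inj h
  exact ⟨Prod.ext (encodeItemset_injective h1) h2, h⟩

theorem encodeFamily_injective {K : ℕ} :
    Function.Injective (fun F : List (Finset (Fin K) × ℚ) => F.flatMap encodePair) := by
  intro F
  induction F with
  | nil =>
    rintro (_ | ⟨y, G⟩) h
    · rfl
    · simp [encodePair] at h
  | cons x F ih =>
    rintro (_ | ⟨y, G⟩) h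
    · simp [encodePair] at h
    · simp only [List.flatMap_cons] at h
      obtain ⟨h1, h⟩ := encodePair_append_inj h
      rw [ih h, h1]

theorem EntrQueryInstance.encode_injective : Function.Injective EntrQueryInstance.encode := by
  rintro ⟨K, F, h1, h2, h3, B, b⟩ ⟨K', F', h1', h2', h3', B', b'⟩ h
  have hK : K = K' := by
    simp only [EntrQueryInstance.encode, encodePair, List.append_assoc, List.cons_append] at h
    obtain ⟨h0, -⟩ :=
      split_comma (comma_notMem_encodeItemset _) (comma_notMem_encodeItemset _) h
    simpa [encodeItemset] using congrArg List.length h0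
  subst hK
  obtain ⟨h4, h5⟩ := encodePair_append_inj h
  cases encodeFamily_injective h5
  cases h4
  rfl

/-- The problem EntrQueryDec: does the maximum entropy distribution that satisfies the frequencies
give the query a frequency larger than the threshold? -/
def EntrQueryDec : DecisionProblem where
  Instance := EntrQueryInstance
  Symbol := Γ'
  finite_symbol := inferInstance
  encode := EntrQueryInstance.encode
  encode_injective := EntrQueryInstance.encode_injective
  yes := {I | ∃ p, IsMaxEntropy I.family p ∧ (I.threshold : ℝ) < frequency p I.query}

end ItemsetQuery

/-! With threshold `0` the problem is about supports. Moving from a distribution `p` a distance `t`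
towards a feasible `q` that charges an outcome where `p` vanishes gains entropy of order `-t log t`,
which beats any loss linear in `t`. So the maximizer charges every outcome that some feasible
distribution charges (`IsMaxEntropy.pos`), and the answer is yes iff some feasible distribution
gives the query positive probability.

The prescribed frequencies are those of a uniform truth assignment together with an independent
uniform choice of one literal per clause. The chosen literal holds with probability 1/2, and a given
literal is chosen and holds with probability 1/6, whether or not the formula is satisfiable; this
gives consistency (`uniformImage_world_mem_satisfying`). A satisfying assignment with a true literal
chosen in every clause is an outcome inside the query. Conversely, on outcomes of positive
probability the frequencies act as logic: frequency 0 is exclusion, equal frequencies of nested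
itemsets are an implication, and 1/2 = 3 · 1/6 makes the clause item imply one of its three
exclusive selectors. An outcome inside the query therefore yields a satisfying assignment
(`satisfiable_of_pos`).

For the complexity, a small language of pushes, pops and loops is compiled to stack machines
(`Cmd.Eval.reaches`). Each encoded itemset consists of runs of zeros, whose lengths are kept in
unary counters, and short constant words. It takes linear time, and the whole output quadratic time.
The unconstrained items 2 and 4 of a clause only serve the encoding: they make the clause part of
the query a repetition of `10`, one copy per literal, so that it can be written in a single scan. -/

namespace ItemsetQuery

open Computability

/-! ### A structured language for multi-stack machines -/

/-- Structured programs over stacks indexed by `S` with symbols in `A`. -/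
inductive Cmd (S A : Type) : Type
  /-- do nothing -/
  | nop : Cmd S A
  /-- push a symbol -/
  | push (s : S) (a : A) : Cmd S A
  /-- run two programs in sequence -/
  | seq (c d : Cmd S A) : Cmd S A
  /-- pop a symbol and branch on it -/
  | pop (s : S) (body : Option A → Cmd S A) : Cmd S A
  /-- pop symbols and run the body on them, until the stack is empty or the popped symbol violates
  the condition -/
  | loop (s : S) (p : A → Bool) (body : A → Cmd S A) : Cmd S A

namespace Cmd

variable {S A : Type}

/-- The control points of a program. -/
def Label : Cmd S A → Type
  | nop => Unit
  | push _ _ => Unit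
  | seq c d => c.Label ⊕ d.Label
  | pop _ body => Option (Σ a, (body a).Label)
  | loop _ _ body => Option (Σ a, (body a).Label)

theorem finite_label [Finite A] (c : Cmd S A) : Finite c.Label := by
  induction c with
  | nop => exact inferInstanceAs (Finite Unit)
  | push => exact inferInstanceAs (Finite Unit)
  | seq c d hc hd => exact inferInstanceAs (Finite (c.Label ⊕ d.Label))
  | pop s body h => exact inferInstanceAs (Finite (Option (Σ a, (body a).Label)))
  | loop s p body h => exact inferInstanceAs (Finite (Option (Σ a, (body a).Label)))

/-- The control point at which a program starts. -/
def entry : (c : Cmd S A) → c.Label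
  | nop => ()
  | push _ _ => ()
  | seq c _ => .inl c.entry
  | pop _ _ => none
  | loop _ _ _ => none

/-- The statement of the compiled machine at a control point. The control points of the program are
placed among the labels `Λ` of the machine by `e`, and the program continues at `x`. -/
def code {Λ : Type} : (c : Cmd S A) → (c.Label → Λ) → Λ → c.Label →
    Turing.TM2.Stmt (fun _ : S => A) Λ (Option A)
  | nop, _, x, _ => .goto fun _ => x
  | push s a, _, x, _ => .push s (fun _ => a) (.goto fun _ => x)
  | seq c d, e, x, l =>
    match l with
    | .inl l => c.code (fun l => e (.inl l)) (e (.inr d.entry)) l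
    | .inr l => d.code (fun l => e (.inr l)) x l
  | pop s body, e, x, l =>
    match l with
    | none => .pop s (fun _ o => o) (.goto fun v => e (some ⟨v, (body v).entry⟩))
    | some ⟨a, l⟩ => (body a).code (fun l => e (some ⟨a, l⟩)) x l
  | loop s p body, e, x, l =>
    match l with
    | none => .pop s (fun _ o => o) (.goto fun v =>
        match v with
        | none => x
        | some a => if p a then e (some ⟨a, (body a).entry⟩) else x)
    | some ⟨a, l⟩ => (body a).code (fun l => e (some ⟨a, l⟩)) (e none) l

variable [DecidableEq S]

/-- `Eval c st st' t`: the program `c` leads from the stacks `st` to the stacks `st'` in at most `t`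
steps. -/
inductive Eval : Cmd S A → (S → List A) → (S → List A) → ℕ → Prop
  | nop (st) : Eval nop st st 1
  | push (s a st) : Eval (push s a) st (Function.update st s (a :: st s)) 1
  | seq {c d st₁ st₂ st₃ t u} : Eval c st₁ st₂ t → Eval d st₂ st₃ u → Eval (seq c d) st₁ st₃ (t + u)
  | pop {s body st st' t} :
    Eval (body (st s).head?) (Function.update st s (st s).tail) st' t →
      Eval (pop s body) st st' (t + 1)
  | loop_nil {s p body st} : st s = [] → Eval (loop s p body) st st 1
  | loop_exit {s p body st a l} : st s = a :: l → p a = false →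
      Eval (loop s p body) st (Function.update st s l) 1
  | loop_step {s p body st st₁ st₂ a l t u} : st s = a :: l → p a = true →
      Eval (body a) (Function.update st s l) st₁ t → Eval (loop s p body) st₁ st₂ u →
      Eval (loop s p body) st st₂ (t + u + 1)
  | mono {c st st' t u} : Eval c st st' t → t ≤ u → Eval c st st' u

/-- Correctness of the compilation, by induction on the run. The placement `e`, the exit label `x`
and the register `v` are arbitrary so that the statement applies to subprograms. The initial
register is irrelevant because every branch follows a pop that overwrites it. -/
theorem Eval.reaches {c : Cmd S A} {st st' : S → List A} {t : ℕ} (h : Eval c st st' t) {Λ : Type}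
    (M : Λ → Turing.TM2.Stmt (fun _ : S => A) Λ (Option A)) (e : c.Label → Λ) (x : Λ)
    (hM : ∀ l, M (e l) = c.code e x l) (v : Option A) :
    ∃ k ≤ t, ∃ v', (flip bind (Turing.TM2.step M))^[k] (some ⟨some (e c.entry), v, st⟩) =
      some ⟨some x, v', st'⟩ := by
  induction h generalizing v x with
  | nop st =>
    exact ⟨1, le_rfl, v, by simp [flip, hM, code]⟩
  | push s a st =>
    exact ⟨1, le_rfl, v, by simp [flip, hM, code]⟩
  | @seq c d st₁ st₂ st₃ t u _ _ ih₁ ih₂ =>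
    obtain ⟨k₁, hk₁, v₁, h₁⟩ := ih₁ (fun l => e (.inl l)) (e (.inr d.entry)) (fun l => hM (.inl l)) v
    obtain ⟨k₂, hk₂, v₂, h₂⟩ := ih₂ (fun l => e (.inr l)) x (fun l => hM (.inr l)) v₁
    refine ⟨k₂ + k₁, by omega, v₂, ?_⟩
    rw [Function.iterate_add_apply]
    exact (congrArg _ h₁).trans h₂
  | @pop s body st st' t _ ih =>
    obtain ⟨k, hk, v', h⟩ := ih (fun l => e (some ⟨_, l⟩)) x (fun l => hM (some ⟨_, l⟩)) (st s).head?
    refine ⟨k + 1, by omega, v', ?_⟩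
    rw [Function.iterate_add_apply, ← h]
    congr 1
    simp [flip, entry, show M (e none) = _ from hM none, code]
  | @loop_nil s p body st hs =>
    refine ⟨1, le_rfl, none, ?_⟩
    have : Function.update st s [] = st := by rw [← hs]; simp
    simp [flip, entry, show M (e none) = _ from hM none, code, hs, this]
  | @loop_exit s p body st a l hs hp =>
    refine ⟨1, le_rfl, some a, ?_⟩
    simp [flip, entry, show M (e none) = _ from hM none, code, hs, hp]
  | @loop_step s p body st st₁ st₂ a l t u hs hp _ _ ih₁ ih₂ =>
    obtain ⟨k₁, hk₁, v₁, h₁⟩ := ih₁ (fun l => e (some ⟨a, l⟩)) (e none) (fun l => hM (some ⟨a, l⟩))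
      (some a)
    obtain ⟨k₂, hk₂, v₂, h₂⟩ := ih₂ e x hM v₁
    refine ⟨k₂ + (k₁ + 1), by omega, v₂, ?_⟩
    rw [Function.iterate_add_apply, Function.iterate_add_apply, ← h₂]
    refine congrArg _ (Eq.trans ?_ h₁)
    congr 1
    simp [flip, entry, show M (e none) = _ from hM none, code, hs, hp]
  | mono _ hle ih =>
    obtain ⟨k, hk, h⟩ := ih e x hM v
    exact ⟨k, hk.trans hle, h⟩

/-- The machine that runs a program and halts. -/
noncomputable def machine [Fintype S] [Fintype A] (c : Cmd S A) (inp out : S) : Turing.FinTM2 where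
  K := S
  k₀ := inp
  k₁ := out
  Γ _ := A
  Λ := Option c.Label
  main := some c.entry
  ΛFin := haveI := c.finite_label; Fintype.ofFinite _
  σ := Option A
  initialState := none
  m l :=
    match l with
    -- `Turing.haltList` prescribes the initial register, so it is reset before halting.
    | none => .load (fun _ => none) .halt
    | some l => c.code some none l

theorem initList_machine [Fintype S] [Fintype A] (c : Cmd S A) (inp out : S) (w : List A) :
    Turing.initList (c.machine inp out) w =
      ⟨some (some c.entry), none, Function.update (fun _ => []) inp w⟩ := by
  unfold Turing.initList
  congr 1
  funext k
  by_cases hk : k = inp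
  · refine (dif_pos hk).trans ?_
    cases (show k = inp from hk)
    exact (Function.update_self (β := fun _ => List A) _ _ _).symm
  · exact (dif_neg hk).trans (Function.update_of_ne (β := fun _ => List A) hk w fun _ => []).symm

theorem haltList_machine [Fintype S] [Fintype A] (c : Cmd S A) (inp out : S) (w : List A) :
    Turing.haltList (c.machine inp out) w =
      ⟨none, none, Function.update (fun _ => []) out w⟩ := by
  unfold Turing.haltList
  congr 1
  funext k
  by_cases hk : k = out
  · refine (dif_pos hk).trans ?_
    cases (show k = out from hk)
    exact (Function.update_self (β := fun _ => List A) _ _ _).symm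
  · exact (dif_neg hk).trans (Function.update_of_ne (β := fun _ => List A) hk w fun _ => []).symm

/-- A program that maps the encoded input to the encoded output, leaves all other stacks empty and
takes polynomial time yields a polynomial-time computable function. -/
theorem computableInPolyTime [Fintype S] [Fintype A] {α β : Type} {ea : α → List A} {eb : β → List A}
    {f : α → β} (c : Cmd S A) (inp out : S) (time : Polynomial ℕ)
    (h : ∀ a, Eval c (Function.update (fun _ => []) inp (ea a))
      (Function.update (fun _ => []) out (eb (f a))) (time.eval (ea a).length)) :
    Nonempty (Turing.TM2ComputableInPolyTime ea eb f) := by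
  have key : ∀ a, Nonempty (Turing.TM2OutputsInTime (c.machine inp out) (ea a)
      (Option.some (eb (f a))) ((time + 1).eval (ea a).length)) := by
    intro a
    obtain ⟨k, hk, v, hv⟩ := (h a).reaches (c.machine inp out).m some none (fun _ => rfl) none
    -- The extra step runs the halting statement.
    refine ⟨⟨⟨k + 1, ?_⟩, ?_⟩⟩
    · rw [Function.iterate_succ_apply', initList_machine]
      exact (congrArg _ hv).trans (congrArg some (haltList_machine c inp out _).symm)
    · simpa using hk
  refine ⟨⟨⟨c.machine inp out, Equiv.refl A, Equiv.refl A⟩, time + 1, fun a => ?_⟩⟩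
  have h₁ : List.map (Equiv.refl A).invFun (ea a) = ea a := List.map_id _
  have h₂ : List.map (Equiv.refl A).invFun (eb (f a)) = eb (f a) := List.map_id _
  exact cast (congrArg₂ (fun u v => Turing.TM2OutputsInTime (c.machine inp out) u
    (Option.some v) ((time + 1).eval (ea a).length)) h₁.symm h₂.symm) (key a).some

end Cmd

/-! ### Maximum entropy distributions -/

theorem continuous_entropy (K : ℕ) : Continuous (entropy : ((Fin K → Bool) → ℝ) → ℝ) :=
  continuous_finsetSum _ fun ω _ => Real.continuous_negMulLog.comp (continuous_apply ω)

theorem isCompact_satisfying {K : ℕ} (F : List (Finset (Fin K) × ℚ)) :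
    IsCompact (satisfying F) := by
  have h : satisfying F = stdSimplex ℝ (Fin K → Bool) ∩
      ⋂ B ∈ F, {p | frequency p B.1 = (B.2 : ℝ)} := by
    ext p; simp [satisfying]
  rw [h]
  refine (isCompact_stdSimplex ℝ _).inter_right (isClosed_biInter fun B _ => ?_)
  exact isClosed_eq (continuous_finsetSum _ fun ω _ => continuous_apply ω) continuous_const

theorem exists_isMaxEntropy {K : ℕ} {F : List (Finset (Fin K) × ℚ)} (h : (satisfying F).Nonempty) :
    ∃ p, IsMaxEntropy F p := by
  obtain ⟨p, hp, hmax⟩ :=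
    (isCompact_satisfying F).exists_isMaxOn h (continuous_entropy K).continuousOn
  exact ⟨p, hp, fun q hq => hmax hq⟩

theorem convex_satisfying {K : ℕ} (F : List (Finset (Fin K) × ℚ)) : Convex ℝ (satisfying F) := by
  rintro p ⟨hp, hpF⟩ q ⟨hq, hqF⟩ a b ha hb hab
  refine ⟨convex_stdSimplex ℝ _ hp hq ha hb hab, fun B hB => ?_⟩
  have : frequency (a • p + b • q) B.1 = a * frequency p B.1 + b * frequency q B.1 := by
    simp [frequency, Finset.sum_add_distrib, Finset.mul_sum]
  rw [this, hpF B hB, hqF B hB, ← add_mul, hab, one_mul]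

/-- The support of the maximum entropy distribution contains the support of every distribution that
satisfies the frequencies. -/
theorem IsMaxEntropy.pos {K : ℕ} {F : List (Finset (Fin K) × ℚ)} {p q : (Fin K → Bool) → ℝ}
    (hp : IsMaxEntropy F p) (hq : q ∈ satisfying F) {ω : Fin K → Bool} (hω : 0 < q ω) :
    0 < p ω := by
  refine lt_of_le_of_ne (hp.1.1.1 ω) fun h0 => ?_
  -- Since `log t` tends to `-∞` at `0`, a small `t` makes the gain `-t log t * q ω` exceed `t`
  -- times the entropy difference.
  obtain ⟨t, ht0, ht1, ht⟩ : ∃ t : ℝ, 0 < t ∧ t < 1 ∧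
      Real.log t * q ω < entropy q - entropy p := by
    have h1 : Filter.Tendsto (fun t => Real.log t * q ω) (nhdsWithin 0 (Set.Ioi 0)) Filter.atBot :=
      Real.tendsto_log_nhdsGT_zero.atBot_mul_const hω
    have h2 := h1.eventually (Filter.eventually_lt_atBot (entropy q - entropy p))
    have h3 : ∀ᶠ t : ℝ in nhdsWithin 0 (Set.Ioi 0), t ∈ Set.Ioo (0 : ℝ) 1 :=
      Ioo_mem_nhdsGT one_pos
    obtain ⟨t, h4, h5⟩ := (h2.and h3).exists
    exact ⟨t, h5.1, h5.2, h4⟩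
  have hconc : ∀ ω', (1 - t) * Real.negMulLog (p ω') + t * Real.negMulLog (q ω') ≤
      Real.negMulLog ((1 - t) * p ω' + t * q ω') := fun ω' => by
    simpa using Real.concaveOn_negMulLog.2 (hp.1.1.1 ω') (hq.1.1 ω') (sub_nonneg.2 ht1.le) ht0.le
      (by ring)
  -- At `ω`, where `p` vanishes, the concavity bound improves by exactly `-t log t * q ω`.
  have hstrict : (1 - t) * Real.negMulLog (p ω) + t * Real.negMulLog (q ω) - t * Real.log t * q ω =
      Real.negMulLog ((1 - t) * p ω + t * q ω) := by
    rw [← h0]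
    simp only [Real.negMulLog_zero, mul_zero, zero_add, Real.negMulLog_mul]
    simp only [Real.negMulLog]
    ring
  have hle := hp.2 _ (convex_satisfying F hp.1 hq (sub_nonneg.2 ht1.le) ht0.le (by ring))
  have hsum : (1 - t) * entropy p + t * entropy q - t * Real.log t * q ω ≤
      entropy ((1 - t) • p + t • q) := by
    classical
    simp only [entropy, Pi.add_apply, Pi.smul_apply, smul_eq_mul, Finset.mul_sum]
    rw [← Finset.sum_add_distrib, ← Finset.add_sum_erase _ _ (Finset.mem_univ ω),
      ← Finset.add_sum_erase _ (fun x => Real.negMulLog ((1 - t) * p x + t * q x))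
        (Finset.mem_univ ω), ← hstrict]
    have := Finset.sum_le_sum fun x (_ : x ∈ Finset.univ.erase ω) => hconc x
    linarith
  have : t * (Real.log t * q ω) < t * (entropy q - entropy p) := mul_lt_mul_of_pos_left ht ht0
  linarith

/-! ### Frequencies as logical constraints on the support -/

section Frequency

variable {K : ℕ} {p : (Fin K → Bool) → ℝ}

theorem frequency_eq_sum_ite (p : (Fin K → Bool) → ℝ) (B : Finset (Fin K)) :
    frequency p B = ∑ ω, if ∀ i ∈ B, ω i = true then p ω else 0 :=
  Finset.sum_filter _ _

theorem le_frequency (hp : ∀ ω, 0 ≤ p ω) {B : Finset (Fin K)} {ω : Fin K → Bool}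
    (hω : ∀ i ∈ B, ω i = true) : p ω ≤ frequency p B :=
  Finset.single_le_sum (f := p) (fun ω _ => hp ω) (by simpa using hω)

theorem not_forall_of_frequency_eq_zero (hp : ∀ ω, 0 ≤ p ω) {B : Finset (Fin K)}
    (hB : frequency p B = 0) {ω : Fin K → Bool} (hω : 0 < p ω) : ¬∀ i ∈ B, ω i = true :=
  fun h => ((le_frequency hp h).trans_eq hB).not_gt hω

/-- The event of `C` lies inside that of `B`; a charged outcome in the difference would make the
frequencies differ. -/
theorem forall_of_frequency_eq (hp : ∀ ω, 0 ≤ p ω) {B C : Finset (Fin K)} (hBC : B ⊆ C)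
    (h : frequency p B = frequency p C) {ω : Fin K → Bool} (hω : 0 < p ω)
    (hB : ∀ i ∈ B, ω i = true) : ∀ i ∈ C, ω i = true := by
  by_contra hC
  refine h.not_gt (Finset.sum_lt_sum_of_subset (i := ω) ?_ (by simpa using hB) (by simpa using hC)
    hω fun ω _ _ => hp ω)
  intro ω' h
  simp only [Finset.mem_filter_univ] at h ⊢
  exact fun i hi => h i (hBC hi)

/-- If the frequency of an item is the sum of the frequencies of its conjunctions with some items
that exclude each other, it implies one of these items. -/
theorem exists_of_frequency_eq_sum (hp : ∀ ω, 0 ≤ p ω) {ι : Type*} [Fintype ι] {c : Fin K}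
    {e : ι → Fin K} (h : frequency p {c} = ∑ s, frequency p {c, e s})
    (he : ∀ s t, s ≠ t → frequency p {e s, e t} = 0) {ω : Fin K → Bool} (hω : 0 < p ω)
    (hc : ω c = true) : ∃ s, ω (e s) = true := by
  classical
  by_contra! hne
  -- Pointwise comparison: at a charged outcome at most one summand survives, because two of the `e
  -- s` never hold together.
  have h1 : ∀ ω', ∑ s, (if ∀ i ∈ ({c, e s} : Finset (Fin K)), ω' i = true then p ω' else 0) ≤
      if ∀ i ∈ ({c} : Finset (Fin K)), ω' i = true then p ω' else 0 := by
    intro ω'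
    by_cases h2 : ∃ s, ω' c = true ∧ ω' (e s) = true
    · obtain ⟨s, hcs, hs⟩ := h2
      rcases (hp ω').eq_or_lt with h0 | h0
      · simp [← h0]
      rw [Finset.sum_eq_single s]
      · simp [hcs, hs]
      · intro t _ hts
        have := not_forall_of_frequency_eq_zero hp (he t s hts) h0
        rw [if_neg]
        intro h3
        exact this (by simpa [hs] using h3 (e t) (by simp))
      · simp
    · rw [Finset.sum_eq_zero]
      · split_ifs <;> simp [hp]
      · intro s _
        rw [if_neg]
        intro h3
        exact h2 ⟨s, h3 c (by simp), h3 (e s) (by simp)⟩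
  simp only [frequency_eq_sum_ite] at h
  rw [Finset.sum_comm] at h
  -- Equal totals force equality at `ω`, where the left side is `0` and the right side is `p ω`.
  have h2 := (Finset.sum_eq_sum_iff_of_le fun ω' _ => h1 ω').1 h.symm ω (Finset.mem_univ ω)
  simp [hc, hne] at h2
  exact hω.ne h2

end Frequency

/-! ### Distributions that are images of uniform distributions -/

/-- The distribution of `g u` for a uniformly distributed `u`. -/
noncomputable def uniformImage {K : ℕ} {U : Type*} [Fintype U] (g : U → Fin K → Bool)
    (ω : Fin K → Bool) : ℝ :=
  (Finset.univ.filter fun u => g u = ω).card / Fintype.card U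

/-- Counting the `u` by fibres of `g` turns every frequency into a cardinality. -/
theorem frequency_uniformImage {K : ℕ} {U : Type*} [Fintype U] (g : U → Fin K → Bool)
    (B : Finset (Fin K)) :
    frequency (uniformImage g) B =
      (Finset.univ.filter fun u => ∀ i ∈ B, g u i = true).card / Fintype.card U := by
  unfold frequency uniformImage
  rw [← Finset.sum_div, ← Nat.cast_sum]
  congr 2
  rw [Finset.card_eq_sum_card_fiberwise (f := g)
    (t := Finset.univ.filter fun ω => ∀ i ∈ B, ω i = true)]
  · refine Finset.sum_congr rfl fun ω hω => congrArg _ ?_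
    simp only [Finset.mem_filter_univ] at hω
    ext u
    simp only [Finset.mem_filter, Finset.mem_univ, true_and]
    refine ⟨fun h => ?_, fun h => h.2⟩
    subst h
    exact ⟨hω, rfl⟩
  · intro u hu
    simpa using hu

theorem uniformImage_mem_stdSimplex {K : ℕ} {U : Type*} [Fintype U] [Nonempty U]
    (g : U → Fin K → Bool) : uniformImage g ∈ stdSimplex ℝ (Fin K → Bool) := by
  refine ⟨fun ω => by unfold uniformImage; positivity, ?_⟩
  have := frequency_uniformImage g ∅
  simpa [frequency] using this

theorem uniformImage_pos {K : ℕ} {U : Type*} [Fintype U] [Nonempty U] (g : U → Fin K → Bool)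
    (u : U) : 0 < uniformImage g (g u) := by
  have : 0 < (Finset.univ.filter fun u' => g u' = g u).card := Finset.card_pos.2 ⟨u, by simp⟩
  unfold uniformImage
  positivity

/-! ### The instance that belongs to a formula -/

/-- Each clause has six items and each variable has two items. The items of a clause are an item
that says that the clause holds, at position `0`, three items that select a literal that holds, at
positions `1`, `3` and `5`, and two items that are not constrained, at positions `2` and `4`. The
items of a variable say that it is true and that it is false. -/
def itemEquiv (n m : ℕ) : (Fin m × Fin 6) ⊕ (Fin n × Fin 2) ≃ Fin (m * 6 + n * 2) :=
  (Equiv.sumCongr finProdFinEquiv finProdFinEquiv).trans finSumFinEquiv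

/-- The itemset with the given items of clauses and the given items of variables. -/
def itemset {n m : ℕ} (P : Finset (Fin m × Fin 6)) (Q : Finset (Fin n × Fin 2)) :
    Finset (Fin (m * 6 + n * 2)) :=
  (P.disjSum Q).map (itemEquiv n m).toEmbedding

/-- The position of the item that selects a literal of a clause. -/
def slot : Fin 3 → Fin 6 := ![1, 3, 5]

/-- The literals of a clause. -/
def literalAt {n : ℕ} (c : Literal n × Literal n × Literal n) : Fin 3 → Literal n :=
  ![c.1, c.2.1, c.2.2]

/-- The position of the item of a variable that says that it has the given value. -/
def valueSlot (b : Bool) : Fin 2 := if b then 0 else 1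

/-- The constraints on the items of a variable. -/
def varPatterns : List (Finset (Fin 2) × ℚ) := [({0}, 1 / 2), ({1}, 1 / 2), ({0, 1}, 0)]

/-- The constraints on the items of a clause. -/
def clausePatterns : List (Finset (Fin 6) × ℚ) :=
  [({0}, 1 / 2), ({1}, 1 / 6), ({3}, 1 / 6), ({5}, 1 / 6), ({0, 1}, 1 / 6), ({0, 3}, 1 / 6),
    ({0, 5}, 1 / 6), ({1, 3}, 0), ({1, 5}, 0), ({3, 5}, 0)]

variable {n m : ℕ}

/-- The members of the family that belong to a variable. -/
def varFamily (m : ℕ) (v : Fin n) : List (Finset (Fin (m * 6 + n * 2)) × ℚ) :=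
  varPatterns.map fun q => (itemset ∅ ({v} ×ˢ q.1), q.2)

/-- The members of the family that belong to a clause. -/
def clauseFamily (j : Fin m) (c : Literal n × Literal n × Literal n) :
    List (Finset (Fin (m * 6 + n * 2)) × ℚ) :=
  (clausePatterns.map fun q => (itemset ({j} ×ˢ q.1) ∅, q.2)) ++
    [0, 1, 2].map fun s => (itemset ({j} ×ˢ {slot s})
      ({(literalAt c s).1} ×ˢ {valueSlot (literalAt c s).2}), 1 / 6)

namespace ThreeCNF

variable (φ : ThreeCNF)

/-- The constrained itemsets and their frequencies. -/
def family : List (Finset (Fin (φ.clauses.length * 6 + φ.numVars * 2)) × ℚ) :=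
  (itemset ∅ ∅, 1) :: (List.finRange φ.numVars).flatMap (varFamily φ.clauses.length) ++
    (List.finRange φ.clauses.length).flatMap fun j => clauseFamily j φ.clauses[j]

/-- The query: all clauses hold. -/
def query : Finset (Fin (φ.clauses.length * 6 + φ.numVars * 2)) :=
  itemset (Finset.univ ×ˢ {0, 2, 4}) ∅

end ThreeCNF

/-! ### Itemsets as disjoint sums of clause and variable items -/

@[simp]
theorem forall_mem_itemset {P : Finset (Fin m × Fin 6)} {Q : Finset (Fin n × Fin 2)}
    {p : Fin (m * 6 + n * 2) → Prop} :
    (∀ i ∈ itemset P Q, p i) ↔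
      (∀ x ∈ P, p (itemEquiv n m (.inl x))) ∧ ∀ y ∈ Q, p (itemEquiv n m (.inr y)) := by
  simp only [itemset, Finset.mem_map, Finset.mem_disjSum]
  constructor
  · exact fun h => ⟨fun x hx => h _ ⟨_, .inl ⟨x, hx, rfl⟩, rfl⟩,
      fun x hx => h _ ⟨_, .inr ⟨x, hx, rfl⟩, rfl⟩⟩
  · rintro ⟨h₁, h₂⟩ _ ⟨_, ⟨x, hx, rfl⟩ | ⟨x, hx, rfl⟩, rfl⟩
    · exact h₁ x hx
    · exact h₂ x hx

theorem itemset_inj {P P' : Finset (Fin m × Fin 6)} {Q Q' : Finset (Fin n × Fin 2)} :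
    itemset P Q = itemset P' Q' ↔ P = P' ∧ Q = Q' := by
  unfold itemset
  rw [Finset.map_inj]
  constructor
  · intro h
    have h1 := congrArg Finset.toLeft h
    have h2 := congrArg Finset.toRight h
    simpa using And.intro h1 h2
  · rintro ⟨rfl, rfl⟩; rfl

theorem subset_itemset {P : Finset (Fin m × Fin 6)} {Q : Finset (Fin n × Fin 2)}
    {C : Finset (Fin (m * 6 + n * 2))} (h : C ⊆ itemset P Q) :
    ∃ P' ⊆ P, ∃ Q' ⊆ Q, C = itemset P' Q' := by
  refine ⟨(C.map (itemEquiv n m).symm.toEmbedding).toLeft, fun x hx => ?_,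
    (C.map (itemEquiv n m).symm.toEmbedding).toRight, fun x hx => ?_, ?_⟩
  · simp only [Finset.mem_toLeft, Finset.mem_map_equiv, Equiv.symm_symm] at hx
    simpa [itemset] using h hx
  · simp only [Finset.mem_toRight, Finset.mem_map_equiv, Equiv.symm_symm] at hx
    simpa [itemset] using h hx
  · simp [itemset, Finset.toLeft_disjSum_toRight, Finset.map_map]

theorem singleton_product_inj {α β : Type*} {a : α} {s t : Finset β} :
    ({a} : Finset α) ×ˢ s = {a} ×ˢ t ↔ s = t := by
  refine ⟨fun h => ?_, fun h => h ▸ rfl⟩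
  ext b
  simpa using congrArg (fun u => (a, b) ∈ u) h

theorem subset_singleton_product {α β : Type*} [DecidableEq β] {a : α} {s : Finset β}
    {t : Finset (α × β)} (h : t ⊆ {a} ×ˢ s) : ∃ s' ⊆ s, t = {a} ×ˢ s' := by
  refine ⟨t.image Prod.snd, fun b hb => ?_, ?_⟩
  · obtain ⟨⟨a', b'⟩, hx, rfl⟩ := Finset.mem_image.1 hb
    exact (Finset.mem_product.1 (h hx)).2
  · ext ⟨a', b'⟩
    simp only [Finset.mem_product, Finset.mem_singleton, Finset.mem_image, Prod.exists,
      exists_eq_right]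
    constructor
    · intro hx
      exact ⟨by simpa using (Finset.mem_product.1 (h hx)).1, a', hx⟩
    · rintro ⟨rfl, a'', hx⟩
      have := (Finset.mem_product.1 (h hx)).1
      simp only [Finset.mem_singleton] at this
      exact this ▸ hx

/-! ### The family is antimonotonic -/

/-- The patterns of a variable are all nonempty subsets of its two items. The empty itemset is kept
apart because it is shared by all variables and clauses and may be listed only once. -/
theorem mem_varFamily_fst {v : Fin n} {C} :
    C ∈ (varFamily m v).map Prod.fst ↔ ∃ s : Finset (Fin 2), s ≠ ∅ ∧ C = itemset ∅ ({v} ×ˢ s) := by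
  have h : ∀ s : Finset (Fin 2), s ∈ varPatterns.map Prod.fst ↔ s ≠ ∅ := by decide +revert
  simp only [← h, varFamily, List.map_map, List.mem_map, Function.comp]
  constructor
  · rintro ⟨q, hq, rfl⟩; exact ⟨_, ⟨q, hq, rfl⟩, rfl⟩
  · rintro ⟨_, ⟨q, hq, rfl⟩, rfl⟩; exact ⟨q, hq, rfl⟩

theorem mem_clauseFamily_fst {j : Fin m} {c : Literal n × Literal n × Literal n} {C} :
    C ∈ (clauseFamily j c).map Prod.fst ↔
      (∃ s ∈ clausePatterns.map Prod.fst, C = itemset ({j} ×ˢ s) ∅) ∨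
      ∃ s, C = itemset ({j} ×ˢ {slot s})
        ({(literalAt c s).1} ×ˢ {valueSlot (literalAt c s).2}) := by
  simp only [clauseFamily, List.map_append, List.mem_append, List.map_map, List.mem_map,
    Function.comp]
  refine or_congr ?_ ?_
  · constructor
    · rintro ⟨q, hq, rfl⟩; exact ⟨_, ⟨q, hq, rfl⟩, rfl⟩
    · rintro ⟨_, ⟨q, hq, rfl⟩, rfl⟩; exact ⟨q, hq, rfl⟩
  · constructor
    · rintro ⟨s, -, rfl⟩; exact ⟨s, rfl⟩
    · rintro ⟨s, rfl⟩; exact ⟨s, by fin_cases s <;> simp, rfl⟩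

set_option maxRecDepth 10000 in
theorem clausePatterns_antimonotonic : ∀ s ∈ clausePatterns.map Prod.fst, ∀ t ∈ s.powerset,
    t = ∅ ∨ t ∈ clausePatterns.map Prod.fst := by
  decide

theorem slot_mem_clausePatterns : ∀ s, {slot s} ∈ clausePatterns.map Prod.fst := by
  decide

namespace ThreeCNF

variable (φ : ThreeCNF)

theorem mem_family_fst {C} : C ∈ φ.family.map Prod.fst ↔
    C = itemset ∅ ∅ ∨ (∃ v, C ∈ (varFamily φ.clauses.length v).map Prod.fst) ∨
      ∃ j : Fin φ.clauses.length, C ∈ (clauseFamily j φ.clauses[j]).map Prod.fst := by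
  simp only [family, List.map_append, List.map_cons, List.map_flatMap, List.mem_append,
    List.mem_cons, List.mem_flatMap, List.mem_finRange, true_and, or_assoc]

/-- The only sets mixing both kinds of items are the links of a selector with a literal. Their
proper subsets are the empty set, a single selector and a single variable item, all of which are
listed. -/
theorem family_antimonotonic : ∀ B ∈ φ.family.map Prod.fst, ∀ C ⊆ B, C ∈ φ.family.map Prod.fst := by
  intro B hB C hC
  rw [mem_family_fst] at hB ⊢
  have hvar : ∀ (v : Fin φ.numVars) s,
      itemset (m := φ.clauses.length) ∅ ({v} ×ˢ s) = itemset ∅ ∅ ∨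
      ∃ w, itemset ∅ ({v} ×ˢ s) ∈ (varFamily φ.clauses.length w).map Prod.fst := by
    intro v s
    rcases eq_or_ne s ∅ with rfl | hs
    · simp
    · exact .inr ⟨v, mem_varFamily_fst.2 ⟨s, hs, rfl⟩⟩
  rcases hB with rfl | ⟨v, hB⟩ | ⟨j, hB⟩
  · obtain ⟨P, hP, Q, hQ, rfl⟩ := subset_itemset hC
    rw [Finset.subset_empty.1 hP, Finset.subset_empty.1 hQ]
    exact .inl rfl
  · obtain ⟨s, -, rfl⟩ := mem_varFamily_fst.1 hB
    obtain ⟨P, hP, Q, hQ, rfl⟩ := subset_itemset hC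
    obtain ⟨s', -, rfl⟩ := subset_singleton_product hQ
    rw [Finset.subset_empty.1 hP]
    exact (hvar v s').imp_right .inl
  · rcases mem_clauseFamily_fst.1 hB with ⟨s, hs, rfl⟩ | ⟨s, rfl⟩
    · obtain ⟨P, hP, Q, hQ, rfl⟩ := subset_itemset hC
      obtain ⟨s', hs', rfl⟩ := subset_singleton_product hP
      rw [Finset.subset_empty.1 hQ]
      rcases clausePatterns_antimonotonic s hs s' (Finset.mem_powerset.2 hs') with rfl | h
      · simp
      · exact .inr (.inr ⟨j, mem_clauseFamily_fst.2 (.inl ⟨s', h, rfl⟩)⟩)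
    · obtain ⟨P, hP, Q, hQ, rfl⟩ := subset_itemset hC
      obtain ⟨s', hs', rfl⟩ := subset_singleton_product hP
      obtain ⟨t', ht', rfl⟩ := subset_singleton_product hQ
      rcases Finset.subset_singleton_iff.1 hs' with rfl | rfl
      · rw [Finset.product_empty]
        exact (hvar _ t').imp_right .inl
      · right; right
        refine ⟨j, mem_clauseFamily_fst.2 ?_⟩
        rcases Finset.subset_singleton_iff.1 ht' with rfl | rfl
        · exact .inl ⟨_, slot_mem_clausePatterns s, by simp⟩
        · exact .inr ⟨s, rfl⟩

/-! ### The members of the family are distinct -/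

/-- The clause part of a set tells where it comes from: it is empty for the sets of variables, and
otherwise nonempty with all its items in one clause. Within a clause only the links have a variable
part. -/
theorem family_nodup : (φ.family.map Prod.fst).Nodup := by
  have hvar0 : ∀ v : Fin φ.numVars, itemset ∅ ∅ ∉ (varFamily φ.clauses.length v).map Prod.fst := by
    intro v h
    obtain ⟨s, hs, h⟩ := mem_varFamily_fst.1 h
    obtain ⟨x, hx⟩ := Finset.nonempty_iff_ne_empty.2 hs
    have := (itemset_inj.1 h).2
    exact Finset.notMem_empty (v, x) (this ▸ by simpa using hx)
  have hcl : ∀ (j : Fin φ.clauses.length) P Q,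
      itemset P Q ∈ (clauseFamily j φ.clauses[j]).map Prod.fst →
      P.Nonempty ∧ ∀ x ∈ P, x.1 = j := by
    intro j P Q h
    have hne : ∀ s ∈ clausePatterns.map Prod.fst, s.Nonempty := by decide
    rcases mem_clauseFamily_fst.1 h with ⟨s, hs, h⟩ | ⟨s, h⟩
    · obtain ⟨rfl, -⟩ := itemset_inj.1 h
      exact ⟨Finset.Nonempty.product (by simp) (hne s hs), by simp +contextual⟩
    · obtain ⟨rfl, -⟩ := itemset_inj.1 h
      exact ⟨by simp, by simp⟩
  simp only [family, List.map_append, List.map_cons, List.map_flatMap, List.cons_append,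
    List.nodup_cons, List.mem_append, List.mem_flatMap, List.mem_finRange, true_and, not_or,
    not_exists]
  refine ⟨⟨hvar0, fun j h => by simpa using (hcl j _ _ h).1⟩, ?_⟩
  rw [List.nodup_append]
  refine ⟨List.nodup_flatMap.2 ⟨fun v _ => ?_, ?_⟩, List.nodup_flatMap.2 ⟨fun j _ => ?_, ?_⟩, ?_⟩
  · have h : (varPatterns.map Prod.fst).Nodup := by decide
    have h2 := h.map (f := fun s => itemset (m := φ.clauses.length) ∅ ({v} ×ˢ s))
      fun s t hst => singleton_product_inj.1 (itemset_inj.1 hst).2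
    simpa only [varFamily, List.map_map, Function.comp_def] using h2
  · refine (List.nodup_finRange _).imp fun {v w} hvw => ?_
    intro C hv hw
    obtain ⟨s, hs, rfl⟩ := mem_varFamily_fst.1 hv
    obtain ⟨t, ht, h⟩ := mem_varFamily_fst.1 hw
    obtain ⟨x, hx⟩ := Finset.nonempty_iff_ne_empty.2 hs
    have h2 : (v, x) ∈ ({w} : Finset _) ×ˢ t := (itemset_inj.1 h).2 ▸ by simpa using hx
    simp only [Finset.mem_product, Finset.mem_singleton] at h2
    exact hvw h2.1
  · have h : (clausePatterns.map Prod.fst).Nodup := by decide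
    have h2 := h.map (f := fun s => itemset (n := φ.numVars) ({j} ×ˢ s) ∅)
      fun s t hst => singleton_product_inj.1 (itemset_inj.1 hst).1
    have h3 : ([0, 1, 2] : List (Fin 3)).Nodup := by decide
    have hslot : Function.Injective slot := by decide
    -- The slots separate the links; the literals need not, since they may repeat.
    have h4 := h3.map (f := fun s => itemset ({j} ×ˢ {slot s})
      ({(literalAt φ.clauses[j] s).1} ×ˢ {valueSlot (literalAt φ.clauses[j] s).2}))
      fun s t hst => hslot (by simpa using singleton_product_inj.1 (itemset_inj.1 hst).1)
    simp only [clauseFamily, List.map_append, List.map_map]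
    rw [List.nodup_append]
    refine ⟨by simpa only [List.map_map, Function.comp_def] using h2, h4, ?_⟩
    rintro C hC D hD rfl
    obtain ⟨s, -, rfl⟩ := List.mem_map.1 hC
    obtain ⟨t, -, h⟩ := List.mem_map.1 hD
    simpa using (itemset_inj.1 h).2
  · refine (List.nodup_finRange _).imp fun {j k} hjk => ?_
    intro C hj hk
    have : ∃ P Q, C = itemset P Q := by
      rcases mem_clauseFamily_fst.1 hj with ⟨s, -, rfl⟩ | ⟨s, rfl⟩ <;> exact ⟨_, _, rfl⟩
    obtain ⟨P, Q, rfl⟩ := this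
    obtain ⟨⟨x, hx⟩, h1⟩ := hcl j P Q hj
    exact hjk ((h1 x hx).symm.trans ((hcl k P Q hk).2 x hx))
  · rintro C hC D hD rfl
    obtain ⟨v, -, hv⟩ := List.mem_flatMap.1 hC
    obtain ⟨j, -, hj⟩ := List.mem_flatMap.1 hD
    obtain ⟨s, -, rfl⟩ := mem_varFamily_fst.1 hv
    simpa using (hcl j _ _ hj).1

end ThreeCNF

/-! ### The frequencies are consistent -/

theorem two_mul_card_filter_apply_eq {n : ℕ} (v : Fin n) (b : Bool) :
    2 * (Finset.univ.filter fun t : Fin n → Bool => t v = b).card =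
      Fintype.card (Fin n → Bool) := by
  have := Fintype.card_filter_piFinset_const_eq_of_mem (Finset.univ : Finset Bool) v
    (Finset.mem_univ b)
  rw [Fintype.piFinset_univ] at this
  rw [this, Finset.card_univ, Fintype.card_pi_const, Fintype.card_fin, Fintype.card_bool,
    mul_pow_sub_one v.pos.ne']

theorem three_mul_card_filter_apply_eq {m : ℕ} (j : Fin m) (s : Fin 3) :
    3 * (Finset.univ.filter fun r : Fin m → Fin 3 => r j = s).card =
      Fintype.card (Fin m → Fin 3) := by
  have := Fintype.card_filter_piFinset_const_eq_of_mem (Finset.univ : Finset (Fin 3)) j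
    (Finset.mem_univ s)
  rw [Fintype.piFinset_univ] at this
  rw [this, Finset.card_univ, Fintype.card_pi_const, Fintype.card_fin, Fintype.card_fin,
    mul_pow_sub_one j.pos.ne']

instance Literal.instDecidableHolds {n : ℕ} (t : Fin n → Bool) (l : Literal n) :
    Decidable (Literal.Holds t l) :=
  inferInstanceAs (Decidable (t l.1 = l.2))

namespace ThreeCNF

variable (φ : ThreeCNF)

/-- A truth assignment together with the choice of a literal in every clause. -/
abbrev Choice : Type := (Fin φ.numVars → Bool) × (Fin φ.clauses.length → Fin 3)

variable {φ}

/-- The values of the items of a clause. -/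
def clauseValue (u : φ.Choice) (j : Fin φ.clauses.length) : Fin 6 → Bool :=
  ![decide (Literal.Holds u.1 (literalAt φ.clauses[j] (u.2 j))),
    decide (u.2 j = 0 ∧ Literal.Holds u.1 (literalAt φ.clauses[j] 0)), true,
    decide (u.2 j = 1 ∧ Literal.Holds u.1 (literalAt φ.clauses[j] 1)), true,
    decide (u.2 j = 2 ∧ Literal.Holds u.1 (literalAt φ.clauses[j] 2))]

/-- The values of all items. -/
def world (u : φ.Choice) (i : Fin (φ.clauses.length * 6 + φ.numVars * 2)) : Bool :=
  ((itemEquiv _ _).symm i).elim (fun x => clauseValue u x.1 x.2)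
    fun y => ![u.1 y.1, !u.1 y.1] y.2

@[simp]
theorem world_inl (u : φ.Choice) (x : Fin φ.clauses.length × Fin 6) :
    world u (itemEquiv _ _ (.inl x)) = clauseValue u x.1 x.2 := by
  simp [world]

@[simp]
theorem world_inr (u : φ.Choice) (y : Fin φ.numVars × Fin 2) :
    world u (itemEquiv _ _ (.inr y)) = ![u.1 y.1, !u.1 y.1] y.2 := by
  simp [world]

theorem clauseValue_slot (u : φ.Choice) (j : Fin φ.clauses.length) (s : Fin 3) :
    clauseValue u j (slot s) = true ↔ u.2 j = s ∧ Literal.Holds u.1 (literalAt φ.clauses[j] s) := by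
  fin_cases s <;> simp [slot, clauseValue]

theorem world_inr_valueSlot (u : φ.Choice) (l : Literal φ.numVars) :
    (![u.1 l.1, !u.1 l.1] : Fin 2 → Bool) (valueSlot l.2) = true ↔ Literal.Holds u.1 l := by
  obtain ⟨v, b⟩ := l
  cases b <;> simp [valueSlot, Literal.Holds]

theorem card_holds (l : Literal φ.numVars) :
    2 * (Finset.univ.filter fun u : φ.Choice => Literal.Holds u.1 l).card =
      Fintype.card φ.Choice := by
  have : (Finset.univ.filter fun u : φ.Choice => Literal.Holds u.1 l) =
      (Finset.univ.filter fun t : Fin φ.numVars → Bool => t l.1 = l.2) ×ˢ Finset.univ := by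
    ext u
    simp only [Finset.mem_filter, Finset.mem_univ, true_and, Finset.mem_product, and_true]
    rfl
  rw [this, Finset.card_product, ← mul_assoc, two_mul_card_filter_apply_eq, Fintype.card_prod,
    Finset.card_univ]

/-- Assignment and choice are independent, with probabilities 1/2 and 1/3. -/
theorem card_choice_and_holds (j : Fin φ.clauses.length) (s : Fin 3) (l : Literal φ.numVars) :
    6 * (Finset.univ.filter fun u : φ.Choice => u.2 j = s ∧ Literal.Holds u.1 l).card =
      Fintype.card φ.Choice := by
  have : (Finset.univ.filter fun u : φ.Choice => u.2 j = s ∧ Literal.Holds u.1 l) =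
      (Finset.univ.filter fun t : Fin φ.numVars → Bool => t l.1 = l.2) ×ˢ
        (Finset.univ.filter fun r : Fin φ.clauses.length → Fin 3 => r j = s) := by
    ext; simp [Literal.Holds, and_comm]
  rw [this, Finset.card_product, Fintype.card_prod, ← two_mul_card_filter_apply_eq l.1 l.2,
    ← three_mul_card_filter_apply_eq j s]
  ring

/-- Splitting by the chosen position gives three pieces of probability 1/6, even if literals repeat
or contradict each other. -/
theorem card_chosen_holds (j : Fin φ.clauses.length) (l : Fin 3 → Literal φ.numVars) :
    2 * (Finset.univ.filter fun u : φ.Choice => Literal.Holds u.1 (l (u.2 j))).card =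
      Fintype.card φ.Choice := by
  have h1 : ∀ s, (Finset.univ.filter fun u : φ.Choice =>
      Literal.Holds u.1 (l (u.2 j))).filter (fun u => u.2 j = s) =
      Finset.univ.filter fun u : φ.Choice => u.2 j = s ∧ Literal.Holds u.1 (l s) := by
    intro s
    ext u
    simp only [Finset.mem_filter, Finset.mem_univ, true_and]
    constructor
    · rintro ⟨h, rfl⟩; exact ⟨rfl, h⟩
    · rintro ⟨rfl, h⟩; exact ⟨h, rfl⟩
  rw [Finset.card_eq_sum_card_fiberwise (f := fun u : φ.Choice => u.2 j) (t := Finset.univ)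
    (by intro; simp)]
  simp only [h1, Fin.sum_univ_three]
  have h2 := fun s => card_choice_and_holds j s (l s)
  have h3 := h2 0
  have h4 := h2 1
  have h5 := h2 2
  omega

theorem card_world_of_mem_family {S} (hS : S ∈ φ.family) :
    ((Finset.univ.filter fun u : φ.Choice => ∀ i ∈ S.1, world u i = true).card : ℚ) =
      S.2 * Fintype.card φ.Choice := by
  have half : ∀ k : ℕ, 2 * k = Fintype.card φ.Choice →
      (k : ℚ) = 1 / 2 * Fintype.card φ.Choice := by
    rintro k hk; rw [← hk]; push_cast; ring
  have sixth : ∀ k : ℕ, 6 * k = Fintype.card φ.Choice →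
      (k : ℚ) = 1 / 6 * Fintype.card φ.Choice := by
    rintro k hk; rw [← hk]; push_cast; ring
  simp only [family, List.mem_append, List.mem_cons, List.mem_flatMap, List.mem_finRange,
    true_and] at hS
  rcases hS with (rfl | ⟨v, hS⟩) | ⟨j, hS⟩
  · simp
  · simp only [varFamily, varPatterns, List.map_cons, List.map_nil, List.mem_cons, List.not_mem_nil,
      or_false] at hS
    have ht : 2 * (Finset.univ.filter fun u : φ.Choice => u.1 v = true).card = _ :=
      card_holds (v, true)
    have hf : 2 * (Finset.univ.filter fun u : φ.Choice => u.1 v = false).card = _ :=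
      card_holds (v, false)
    rcases hS with rfl | rfl | rfl
    · simpa using half _ ht
    · simpa using half _ hf
    · simp
  · simp only [clauseFamily, List.mem_append] at hS
    have hc := half _ (card_chosen_holds j (literalAt φ.clauses[j]))
    have he := fun s => sixth _ (card_choice_and_holds j s (literalAt φ.clauses[j] s))
    rcases hS with hS | hS
    · simp only [clausePatterns, List.map_cons, List.map_nil, List.mem_cons, List.not_mem_nil,
        or_false] at hS
      -- A selector already implies the clause item, so adding that item does not change the count.
      have h0 : ∀ s, (Finset.univ.filter fun u : φ.Choice => u.2 j = s ∧
          Literal.Holds u.1 (literalAt φ.clauses[j] s)) = Finset.univ.filter fun u : φ.Choice =>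
          Literal.Holds u.1 (literalAt φ.clauses[j] (u.2 j)) ∧ u.2 j = s ∧
          Literal.Holds u.1 (literalAt φ.clauses[j] s) := by
        intro s
        refine Finset.filter_congr fun u _ => ⟨?_, fun h => h.2⟩
        rintro ⟨rfl, h⟩
        exact ⟨h, rfl, h⟩
      have he' := he
      simp only [h0] at he'
      rcases hS with rfl | rfl | rfl | rfl | rfl | rfl | rfl | rfl | rfl | rfl
      · simpa [clauseValue] using hc
      · simpa [clauseValue] using he 0
      · simpa [clauseValue] using he 1
      · simpa [clauseValue] using he 2
      · simpa [clauseValue] using he' 0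
      · simpa [clauseValue] using he' 1
      · simpa [clauseValue] using he' 2
      -- Two selectors would require two values of the choice in the same clause.
      · simp [clauseValue, Finset.filter_eq_empty_iff]; intro a b h1 _ h2; simp [h1] at h2
      · simp [clauseValue, Finset.filter_eq_empty_iff]; intro a b h1 _ h2; simp [h1] at h2
      · simp [clauseValue, Finset.filter_eq_empty_iff]; intro a b h1 _ h2; simp [h1] at h2
    · obtain ⟨s, -, rfl⟩ := List.mem_map.1 hS
      rw [← he s]
      congr 2
      -- A selector is one only if its literal holds, so the variable item is redundant.
      refine Finset.filter_congr fun u _ => ?_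
      simp only [forall_mem_itemset, Finset.mem_product, Finset.mem_singleton, Prod.forall, and_imp,
        forall_eq_apply_imp_iff, forall_eq, world_inl, world_inr, clauseValue_slot,
        world_inr_valueSlot]
      tauto

theorem uniformImage_world_mem_satisfying :
    uniformImage (world (φ := φ)) ∈ satisfying φ.family := by
  refine ⟨uniformImage_mem_stdSimplex _, fun S hS => ?_⟩
  rw [frequency_uniformImage, div_eq_iff (by positivity)]
  exact_mod_cast congrArg (Rat.cast : ℚ → ℝ) (card_world_of_mem_family hS)

variable (φ)

/-- The instance of the maximum entropy query problem that belongs to a formula. -/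
def instanceOf : EntrQueryInstance where
  K := φ.clauses.length * 6 + φ.numVars * 2
  family := φ.family
  nodup := φ.family_nodup
  antimonotonic := φ.family_antimonotonic
  consistent := ⟨_, uniformImage_world_mem_satisfying⟩
  query := φ.query
  threshold := 0

/-! ### The answer is preserved -/

variable {φ}

theorem mem_query_iff {ω : Fin (φ.clauses.length * 6 + φ.numVars * 2) → Bool} :
    (∀ i ∈ φ.query, ω i = true) ↔
      ∀ j, ω (itemEquiv _ _ (.inl (j, 0))) = true ∧ ω (itemEquiv _ _ (.inl (j, 2))) = true ∧
        ω (itemEquiv _ _ (.inl (j, 4))) = true := by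
  simp [query]

/-- Choose a true literal in each clause; the unconstrained items are always one. -/
theorem exists_choice_of_satisfiable (h : φ.Satisfiable) :
    ∃ u : φ.Choice, ∀ i ∈ φ.query, world u i = true := by
  obtain ⟨t, ht⟩ := h
  have : ∀ j : Fin φ.clauses.length, ∃ s, Literal.Holds t (literalAt φ.clauses[j] s) := by
    intro j
    rcases ht φ.clauses[j] (List.getElem_mem _) with h | h | h
    · exact ⟨0, h⟩
    · exact ⟨1, h⟩
    · exact ⟨2, h⟩
  choose r hr using this
  refine ⟨(t, r), mem_query_iff.2 fun j => ?_⟩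
  simpa [clauseValue] using hr j

theorem frequency_of_mem_family {p} (hp : p ∈ satisfying φ.family) {P Q x}
    (h : (itemset P Q, x) ∈ φ.family) : frequency p (itemset P Q) = (x : ℝ) :=
  hp.2 _ h

theorem mem_family_of_clause {S} (j : Fin φ.clauses.length) (h : S ∈ clauseFamily j φ.clauses[j]) :
    S ∈ φ.family :=
  List.mem_append_right _ (List.mem_flatMap.2 ⟨j, List.mem_finRange j, h⟩)

/-- The assignment is read off from the variable items of a charged outcome inside the query. -/
theorem satisfiable_of_pos {p} (hp : p ∈ satisfying φ.family)
    {ω : Fin (φ.clauses.length * 6 + φ.numVars * 2) → Bool} (hω : 0 < p ω)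
    (hq : ∀ i ∈ φ.query, ω i = true) : φ.Satisfiable := by
  have h0 := hp.1.1
  have hitem1 : ∀ (j : Fin φ.clauses.length) (a : Fin 6),
      itemset (n := φ.numVars) ({j} ×ˢ {a}) ∅ = {itemEquiv _ _ (.inl (j, a))} := by
    intro j a; ext; simp [itemset]
  have hitem2 : ∀ (j : Fin φ.clauses.length) (a b : Fin 6),
      itemset (n := φ.numVars) ({j} ×ˢ {a, b}) ∅ =
        {itemEquiv _ _ (.inl (j, a)), itemEquiv _ _ (.inl (j, b))} := by
    intro j a b
    ext
    simp only [itemset, Finset.mem_map_equiv, Finset.mem_disjSum]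
    simp [eq_comm, Equiv.eq_symm_apply]
  have hpat : ∀ (j : Fin φ.clauses.length) s x, (s, x) ∈ clausePatterns →
      frequency p (itemset ({j} ×ˢ s) ∅) = (x : ℝ) := fun j s x h =>
    frequency_of_mem_family hp (mem_family_of_clause j
      (List.mem_append_left _ (List.mem_map.2 ⟨_, h, rfl⟩)))
  -- The clause item has frequency 1/2, the sum of the three joint frequencies 1/6, and the
  -- selectors exclude each other.
  have hselect : ∀ j : Fin φ.clauses.length, ∃ s, ω (itemEquiv _ _ (.inl (j, slot s))) = true := by
    intro j
    refine exists_of_frequency_eq_sum (c := itemEquiv _ _ (.inl (j, 0))) h0 ?_ ?_ hω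
      (mem_query_iff.1 hq j).1
    · have hs : ∀ s, (({0, slot s} : Finset (Fin 6)), (1 / 6 : ℚ)) ∈ clausePatterns := by
        intro s; fin_cases s <;> simp [clausePatterns, slot]
      simp only [← hitem2]
      rw [← hitem1, hpat j _ (1 / 2) (by simp [clausePatterns]),
        Finset.sum_congr rfl fun s _ => hpat j _ _ (hs s)]
      simp
      norm_num
    · intro s t hst
      have hs : ∀ s t, s ≠ t → ({slot s, slot t}, (0 : ℚ)) ∈ clausePatterns := by decide
      rw [← hitem2, hpat j _ _ (hs s t hst)]
      simp
  choose r hr using hselect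
  -- A selector and its link both have frequency 1/6, so the selector implies the item of its
  -- literal.
  have hlit : ∀ j : Fin φ.clauses.length, ω (itemEquiv _ _ (.inr ((literalAt φ.clauses[j] (r j)).1,
      valueSlot (literalAt φ.clauses[j] (r j)).2))) = true := by
    intro j
    have hsub : itemset ({j} ×ˢ {slot (r j)}) ∅ ⊆ itemset ({j} ×ˢ {slot (r j)})
        ({(literalAt φ.clauses[j] (r j)).1} ×ˢ {valueSlot (literalAt φ.clauses[j] (r j)).2}) :=
      Finset.map_subset_map.2 (Finset.disjSum_mono subset_rfl (Finset.empty_subset _))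
    have hs : ∀ s, ({slot s}, (1 / 6 : ℚ)) ∈ clausePatterns := by
      intro s; fin_cases s <;> simp [clausePatterns, slot]
    have hfreq : frequency p (itemset ({j} ×ˢ {slot (r j)}) ∅) = frequency p (itemset
        ({j} ×ˢ {slot (r j)}) ({(literalAt φ.clauses[j] (r j)).1} ×ˢ
          {valueSlot (literalAt φ.clauses[j] (r j)).2})) := by
      rw [hpat j _ _ (hs _), frequency_of_mem_family (x := 1 / 6) hp (mem_family_of_clause j
        (List.mem_append_right _ (List.mem_map.2 ⟨r j, ?_, rfl⟩)))]
      generalize r j = s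
      fin_cases s <;> simp
    have := forall_of_frequency_eq h0 hsub hfreq hω (by rw [hitem1]; simpa using hr j)
    exact (forall_mem_itemset.1 this).2 _ (by simp)
  have hexcl : ∀ v : Fin φ.numVars, ¬(ω (itemEquiv _ _ (.inr (v, 0))) = true ∧
      ω (itemEquiv _ _ (.inr (v, 1))) = true) := by
    intro v
    have hv := frequency_of_mem_family (x := 0) (P := ∅) (Q := {v} ×ˢ {0, 1}) hp
      (List.mem_append_left _ (List.mem_cons_of_mem _ (List.mem_flatMap.2 ⟨v, List.mem_finRange v,
        by simp [varFamily, varPatterns]⟩)))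
    simpa using not_forall_of_frequency_eq_zero h0 (hv.trans (by simp)) hω
  -- Only the "true" item defines `t`; negative literals are handled by `hexcl`.
  let t : Fin φ.numVars → Bool := fun v => ω (itemEquiv _ _ (.inr (v, 0)))
  have hholds : ∀ j : Fin φ.clauses.length, Literal.Holds t (literalAt φ.clauses[j] (r j)) := by
    intro j
    have h1 := hlit j
    generalize literalAt φ.clauses[j] (r j) = l at h1 ⊢
    obtain ⟨v, b⟩ := l
    cases b
    · have := hexcl v
      simp only [valueSlot] at h1
      simp only [not_and] at this
      simpa [Literal.Holds, t] using fun h => this h h1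
    · exact h1
  refine ⟨t, fun c hc => ?_⟩
  obtain ⟨j, hj, rfl⟩ := List.getElem_of_mem hc
  have h1 := hholds ⟨j, hj⟩
  generalize r ⟨j, hj⟩ = s at h1
  fin_cases s
  · exact .inl h1
  · exact .inr (.inl h1)
  · exact .inr (.inr h1)

theorem satisfiable_iff_instanceOf_mem_yes : φ ∈ ThreeSAT.yes ↔ φ.instanceOf ∈ EntrQueryDec.yes := by
  change φ.Satisfiable ↔ ∃ p, IsMaxEntropy φ.family p ∧ ((0 : ℚ) : ℝ) < frequency p φ.query
  rw [Rat.cast_zero]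
  constructor
  · intro h
    obtain ⟨p, hp⟩ := exists_isMaxEntropy φ.instanceOf.consistent
    obtain ⟨u, hu⟩ := exists_choice_of_satisfiable h
    exact ⟨p, hp, (hp.pos uniformImage_world_mem_satisfying (uniformImage_pos world u)).trans_le
      (le_frequency hp.1.1.1 hu)⟩
  · rintro ⟨p, hp, hpos⟩
    obtain ⟨ω, hω, hω0⟩ := Finset.exists_ne_zero_of_sum_ne_zero hpos.ne'
    exact satisfiable_of_pos hp.1 ((hp.1.1.1 ω).lt_of_ne' hω0) (by simpa using hω)

end ThreeCNF

/-! ### The word that encodes the instance -/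

/-- A word of zeros. -/
def zeros (k : ℕ) : List Γ' := List.replicate k (Γ'.bit false)

/-- The word of an itemset with its frequency; `P` and `Q` are the parts of the characteristic
vector that are not zero. -/
def setWord (a : ℕ) (P : List Γ') (b c : ℕ) (Q : List Γ') (d : ℕ) (x : ℚ) : List Γ' :=
  zeros a ++ P ++ zeros b ++ zeros c ++ Q ++ zeros d ++ Γ'.comma :: encodeRat x

theorem flatten_replicate_zeros (j k : ℕ) : (List.replicate j (zeros k)).flatten = zeros (j * k) := by
  simp [zeros]

theorem flatMap_finRange_ite {α : Type*} {m : ℕ} (j : Fin m) (w z : List α) :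
    (List.finRange m).flatMap (fun k => if k = j then w else z) =
      (List.replicate j z).flatten ++ w ++ (List.replicate (m - 1 - j) z).flatten := by
  induction m with
  | zero => exact j.elim0
  | succ m ih =>
    rw [List.finRange_succ, List.flatMap_cons, List.flatMap_map]
    refine Fin.cases ?_ (fun j => ?_) j
    · simp [List.flatMap_def, List.map_const', Fin.succ_ne_zero]
    · have h : (0 : Fin (m + 1)) ≠ j.succ := (Fin.succ_ne_zero j).symm
      simp only [h, if_false, Fin.succ_inj, ih, Fin.val_succ, List.replicate_succ,
        List.flatten_cons, List.append_assoc]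
      rw [show m + 1 - 1 - (j + 1 : ℕ) = m - 1 - j by omega]

theorem encodeItemset_empty (k : ℕ) : encodeItemset (∅ : Finset (Fin k)) = zeros k := by
  simp [encodeItemset, zeros, List.ofFn_const]

/-- `finProdFinEquiv` is row-major, so the items of one clause or variable form a contiguous block.
-/
theorem ofFn_finProdFinEquiv {α : Type*} {m k : ℕ} (f : Fin (m * k) → α) :
    List.ofFn f = (List.finRange m).flatMap fun j =>
      List.ofFn fun i => f (finProdFinEquiv (j, i)) := by
  rw [List.ofFn_mul, List.flatMap_def, ← List.ofFn_eq_map]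
  congr 2
  funext j
  congr 1
  funext i
  congr 1
  ext
  simp [finProdFinEquiv, mul_comm, add_comm]

theorem mem_itemset_inl {n m : ℕ} {P : Finset (Fin m × Fin 6)} {Q : Finset (Fin n × Fin 2)} {x} :
    itemEquiv n m (.inl x) ∈ itemset P Q ↔ x ∈ P := by
  simp [itemset]

theorem mem_itemset_inr {n m : ℕ} {P : Finset (Fin m × Fin 6)} {Q : Finset (Fin n × Fin 2)} {x} :
    itemEquiv n m (.inr x) ∈ itemset P Q ↔ x ∈ Q := by
  simp [itemset]

theorem encodeItemset_itemset {n m : ℕ} (P : Finset (Fin m × Fin 6)) (Q : Finset (Fin n × Fin 2)) :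
    encodeItemset (itemset P Q) =
      ((List.finRange m).flatMap fun j => encodeItemset {k | (j, k) ∈ P}) ++
        (List.finRange n).flatMap fun v => encodeItemset {k | (v, k) ∈ Q} := by
  unfold encodeItemset
  rw [List.ofFn_add, ofFn_finProdFinEquiv, ofFn_finProdFinEquiv]
  congr 1
  · congr 1
    funext j
    congr 1
    funext k
    congr 2
    exact propext (mem_itemset_inl.trans (by simp))
  · congr 1
    funext j
    congr 1
    funext k
    congr 2
    exact propext (mem_itemset_inr.trans (by simp))

theorem flatMap_encodeItemset_empty {m k : ℕ} :
    ((List.finRange m).flatMap fun j => encodeItemset {i : Fin k | (j, i) ∈ (∅ : Finset _)}) =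
      zeros (m * k) := by
  simp [encodeItemset_empty, List.flatMap_def, flatten_replicate_zeros, List.map_const']

theorem flatMap_encodeItemset_singleton_product {m k : ℕ} (j : Fin m) (s : Finset (Fin k)) :
    ((List.finRange m).flatMap fun j' => encodeItemset {i | (j', i) ∈ ({j} : Finset _) ×ˢ s}) =
      zeros (j * k) ++ encodeItemset s ++ zeros ((m - 1 - j) * k) := by
  rw [← flatten_replicate_zeros, ← flatten_replicate_zeros, ← encodeItemset_empty,
    ← flatMap_finRange_ite]
  congr 1
  funext j'
  split_ifs with h
  · congr 1; ext; simp [h]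
  · congr 1; ext; simp [Ne.symm h]

/-- The words of the members of the family that belong to a variable. -/
def varWord (n m v : ℕ) : List Γ' :=
  varPatterns.flatMap fun q =>
    setWord 0 [] (m * 6) (v * 2) (encodeItemset q.1) ((n - 1 - v) * 2) q.2

/-- The words of the members of the family that belong to a clause. -/
def clauseWord (m : ℕ) {n : ℕ} (c : Literal n × Literal n × Literal n) (j : ℕ) : List Γ' :=
  (clausePatterns.flatMap fun q =>
    setWord (j * 6) (encodeItemset q.1) ((m - 1 - j) * 6) 0 [] (n * 2) q.2) ++
  [0, 1, 2].flatMap fun s =>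
    setWord (j * 6) (encodeItemset {slot s}) ((m - 1 - j) * 6) ((literalAt c s).1 * 2)
      (encodeItemset {valueSlot (literalAt c s).2}) ((n - 1 - (literalAt c s).1) * 2) (1 / 6)

theorem flatMap_encodePair_varFamily {n m : ℕ} (v : Fin n) :
    (varFamily m v).flatMap encodePair = varWord n m v := by
  simp only [varFamily, varWord, List.flatMap_map, encodePair, encodeItemset_itemset,
    flatMap_encodeItemset_empty, flatMap_encodeItemset_singleton_product, setWord]
  simp [zeros, -List.replicate_append_replicate]

theorem flatMap_encodePair_clauseFamily {n m : ℕ} (j : Fin m)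
    (c : Literal n × Literal n × Literal n) :
    (clauseFamily j c).flatMap encodePair = clauseWord m c j := by
  simp only [clauseFamily, clauseWord, List.flatMap_append, List.flatMap_map, encodePair,
    encodeItemset_itemset, flatMap_encodeItemset_empty, flatMap_encodeItemset_singleton_product,
    setWord]
  simp [zeros, -List.replicate_append_replicate]

/-- Replaces dependent indices by a running number, which suits an induction over the clause list.
-/
theorem flatMap_finRange_getElem {α β : Type*} (l : List α) (f : α → ℕ → List β) :
    ((List.finRange l.length).flatMap fun j : Fin l.length => f l[j] j) =
      l.zipIdx.flatMap fun x => f x.1 x.2 := by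
  rw [List.flatMap_def, List.flatMap_def]
  congr 1
  refine List.ext_getElem (by simp) fun i h₁ h₂ => ?_
  simp

theorem flatMap_finRange_val {β : Type*} (n : ℕ) (f : ℕ → List β) :
    ((List.finRange n).flatMap fun v : Fin n => f v) = (List.range' 0 n).flatMap f := by
  rw [← List.range_eq_range', ← List.map_coe_finRange_eq_range, List.flatMap_map]

/-- The word of the characteristic vector of the query. -/
def queryWord (m n : ℕ) : List Γ' :=
  (List.replicate (m * 3) [Γ'.bit true, Γ'.bit false]).flatten ++ zeros (n * 2)

/-- The block of a clause is `101010`, one `10` per literal. -/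
theorem encodeItemset_query (φ : ThreeCNF) :
    encodeItemset φ.query = queryWord φ.clauses.length φ.numVars := by
  have h : encodeItemset ({0, 2, 4} : Finset (Fin 6)) =
      (List.replicate 3 [Γ'.bit true, Γ'.bit false]).flatten := by decide
  rw [ThreeCNF.query, encodeItemset_itemset, flatMap_encodeItemset_empty, queryWord]
  congr 1
  have : ∀ j : Fin φ.clauses.length, ({k | (j, k) ∈ Finset.univ ×ˢ ({0, 2, 4} : Finset (Fin 6))} :
      Finset (Fin 6)) = {0, 2, 4} := by intro j; ext; simp
  simp only [this, h, List.flatMap_def, List.map_const', List.length_finRange]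
  generalize φ.clauses.length = m
  induction m with
  | zero => rfl
  | succ m ih =>
    rw [List.replicate_succ, List.flatten_cons, ih, Nat.succ_mul, Nat.add_comm,
      List.replicate_add, List.flatten_append]

/-- The specification that the program meets: the output as pieces whose runs of zeros have lengths
available in counters. -/
theorem encode_instanceOf (φ : ThreeCNF) :
    φ.instanceOf.encode = queryWord φ.clauses.length φ.numVars ++ Γ'.comma :: encodeRat 0 ++
      setWord 0 [] (φ.clauses.length * 6) 0 [] (φ.numVars * 2) 1 ++
      (List.range' 0 φ.numVars).flatMap (varWord φ.numVars φ.clauses.length) ++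
      φ.clauses.zipIdx.flatMap fun x => clauseWord φ.clauses.length x.1 x.2 := by
  have h : φ.instanceOf.encode =
      encodePair (φ.query, (0 : ℚ)) ++ φ.family.flatMap encodePair := rfl
  rw [h, ← flatMap_finRange_val, ← flatMap_finRange_getElem, ThreeCNF.family, List.flatMap_append,
    List.flatMap_cons, List.flatMap_assoc, List.flatMap_assoc]
  simp only [flatMap_encodePair_varFamily, flatMap_encodePair_clauseFamily]
  simp only [encodePair, encodeItemset_query, encodeItemset_itemset, flatMap_encodeItemset_empty,
    setWord]
  simp [zeros, -List.replicate_append_replicate]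

theorem length_encodeRat_le {x : ℚ} (h : x ∈ [0, 1, 1 / 2, 1 / 6]) :
    (encodeRat x).length ≤ 10 := by
  simp only [List.mem_cons, List.not_mem_nil, or_false] at h
  rcases h with rfl | rfl | rfl | rfl <;> decide +kernel

/-! ### Running times of composite programs -/

namespace Cmd

variable {S A : Type}

/-- Run the programs of a list in sequence. -/
def seqs : List (Cmd S A) → Cmd S A
  | [] => nop
  | c :: L => seq c (seqs L)

/-- Push several symbols. -/
def pushes (L : List (S × A)) : Cmd S A := seqs (L.map fun x => push x.1 x.2)

/-- Pop a symbol and ignore it. -/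
def drop (s : S) : Cmd S A := pop s fun _ => nop

variable [DecidableEq S]

/-- The stacks after several symbols were pushed. -/
def pushed (L : List (S × A)) (st : S → List A) (s : S) : List A :=
  ((L.filter fun x => x.1 = s).map Prod.snd).reverse ++ st s

@[simp]
theorem pushed_nil (st : S → List A) : pushed [] st = st := by
  funext s; simp [pushed]

theorem pushed_cons (x : S × A) (L : List (S × A)) (st : S → List A) :
    pushed (x :: L) st = pushed L (Function.update st x.1 (x.2 :: st x.1)) := by
  funext s
  by_cases h : x.1 = s
  · subst h; simp [pushed]
  · simp [pushed, h, Function.update_of_ne (Ne.symm h)]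

theorem pushed_append (L M : List (S × A)) (st : S → List A) :
    pushed (L ++ M) st = pushed M (pushed L st) := by
  funext s; simp [pushed]

theorem eval_pushes (L : List (S × A)) (st : S → List A) :
    Eval (pushes L) st (pushed L st) (L.length + 1) := by
  induction L generalizing st with
  | nil => simpa [pushes, seqs] using Eval.nop st
  | cons x L ih =>
    rw [pushed_cons]
    exact (Eval.seq (.push x.1 x.2 st) (ih _)).mono (by simp; omega)

theorem eval_drop {s : S} {st : S → List A} {a : A} {l : List A} (h : st s = a :: l) :
    Eval (drop s) st (Function.update st s l) 2 := by
  have := Eval.nop (Function.update st s (st s).tail)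
  rw [h, List.tail_cons] at this
  exact .pop (by rwa [h, List.tail_cons])

/-- Running a program for each element of a list, where every run appends to a word. -/
theorem eval_seqs_map {ι β : Type*} {g : ι → Cmd S A} {F : List β → S → List A} {o : ι → List β}
    {t : ℕ} {L : List ι} (h : ∀ q ∈ L, ∀ w, Eval (g q) (F w) (F (w ++ o q)) t) (w : List β) :
    Eval (seqs (L.map g)) (F w) (F (w ++ L.flatMap o)) (t * L.length + 1) := by
  induction L generalizing w with
  | nil => simpa [seqs] using Eval.nop (F w)
  | cons q L ih =>
    rw [List.flatMap_cons, ← List.append_assoc]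
    refine (Eval.seq (h q (by simp) w) (ih (fun q hq => h q (by simp [hq])) _)).mono ?_
    rw [List.length_cons, Nat.mul_succ]
    omega

/-- A stack grows by at most one symbol per step. -/
theorem Eval.length_le {c : Cmd S A} {st st' : S → List A} {t : ℕ} (h : Eval c st st' t) (s : S) :
    (st' s).length ≤ (st s).length + t := by
  induction h with
  | nop => simp
  | push s' a st =>
    by_cases hs : s = s'
    · subst hs; simp
    · simp [hs]
  | seq _ _ ih₁ ih₂ => omega
  | @pop s' body st st' t _ ih =>
    by_cases hs : s = s'
    · subst hs; simp at ih; omega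
    · simp [hs] at ih; omega
  | loop_nil => simp
  | @loop_exit s' _ _ st a l hst =>
    by_cases hs : s = s'
    · subst hs; simp [hst]; omega
    · simp [hs]
  | @loop_step s' _ _ st st₁ st₂ a l t u hst _ _ _ ih₁ ih₂ =>
    by_cases hs : s = s'
    · subst hs; simp at ih₁; simp [hst]; omega
    · simp [hs] at ih₁; omega
  | mono _ _ ih => omega

/-- A loop that pops symbols and pushes symbols on other stacks. -/
theorem eval_loop_pushes {s : S} {p : A → Bool} {f : A → List (S × A)} {k : ℕ}
    (hf : ∀ a, ∀ x ∈ f a, x.1 ≠ s) (hk : ∀ a, (f a).length ≤ k) {l r : List A}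
    (hl : ∀ a ∈ l, p a = true) (hr : ∀ b ∈ r.head?, p b = false) {st : S → List A}
    (hst : st s = l ++ r) :
    Eval (loop s p fun a => pushes (f a)) st
      (pushed (l.flatMap f) (Function.update st s r.tail)) ((k + 2) * l.length + 1) := by
  induction l generalizing st with
  | nil =>
    cases r with
    | nil =>
      have : Function.update st s [] = st := by rw [← (show st s = [] from hst)]; simp
      simpa [this] using Eval.loop_nil hst
    | cons b r => simpa using Eval.loop_exit hst (hr b (by simp))
  | cons a l ih =>
    -- The body never pushes on `s`, so the remaining symbols stay in place.
    have h1 : pushed (f a) (Function.update st s (l ++ r)) s = l ++ r := by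
      have : (f a).filter (fun x => x.1 = s) = [] := by
        simpa [List.filter_eq_nil_iff] using hf a
      simp [pushed, this]
    have h2 := ih (fun a ha => hl a (by simp [ha])) h1
    have h3 : Function.update (pushed (f a) (Function.update st s (l ++ r))) s r.tail =
        pushed (f a) (Function.update st s r.tail) := by
      funext t
      by_cases ht : t = s
      · subst ht
        have : (f a).filter (fun x => x.1 = t) = [] := by
          simpa [List.filter_eq_nil_iff] using hf a
        simp [pushed, this]
      · simp [pushed, ht]
    rw [h3, ← pushed_append, ← List.flatMap_cons] at h2
    -- Each round costs at most `k` pushes, the closing `nop` and the pop; the last `+ 1` is the pop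
    -- that ends the loop.
    refine (Eval.loop_step hst (hl a (by simp)) (eval_pushes _ _) h2).mono ?_
    have := hk a
    rw [List.length_cons, Nat.mul_succ]
    omega

end Cmd

/-! ### The program -/

/-- The stacks of the program: the input; counters for the items of the variables, of the clauses
that were processed and of the clauses that were not; a stack for intermediate results; the index of
a variable; the reversed output; the output. -/
inductive Tape
  | inp | vars | past | rest | tmp | idx | acc | out
  deriving DecidableEq

instance : Fintype Tape where
  elems := {.inp, .vars, .past, .rest, .tmp, .idx, .acc, .out}
  complete x := by cases x <;> simp

namespace Program

open Cmd Tape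

/-- Append a constant word to the output. -/
def emit (w : List Γ') : Cmd Tape Γ' := pushes (w.map fun a => (acc, a))

/-- Append as many zeros to the output as the counter says. -/
def emitZeros (c : Tape) : Cmd Tape Γ' :=
  seq (loop c (fun _ => true) fun _ => pushes [(tmp, .blank), (acc, .bit false)])
    -- The counter is restored because later itemsets use it again.
    (loop tmp (fun _ => true) fun _ => pushes [(c, .blank)])

/-- Append an itemset with its frequency. -/
def emitSet (P Q : List Γ') (x : ℚ) : Cmd Tape Γ' :=
  seqs [emitZeros past, emit P, emitZeros rest, emitZeros idx, emit Q, emitZeros vars,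
    emit (.comma :: encodeRat x)]

/-- Move two symbols from the items of the variables to the index. -/
def advance : Cmd Tape Γ' :=
  seqs [drop vars, drop vars, pushes [(idx, .blank), (idx, .blank)]]

/-- Move the index back to the items of the variables. -/
def resetIdx : Cmd Tape Γ' := loop idx (fun _ => true) fun _ => pushes [(vars, .blank)]

/-- Append the members of the family that belong to the variables. -/
def emitVars : Cmd Tape Γ' :=
  -- The loop itself pops the first item of the variable and `drop` the second, so that `vars`
  -- counts the items of the later variables.
  seq (loop vars (fun _ => true) fun _ => seqs [drop vars,
    seqs (varPatterns.map fun q => emitSet [] (encodeItemset q.1) q.2),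
    pushes [(idx, .blank), (idx, .blank)]]) resetIdx

/-- Append the member of the family that links a literal of a clause to its variable. -/
def emitLiteral (b : Bool) (s : Fin 3) : Cmd Tape Γ' :=
  -- The loop also consumes the comma that ends the literal. The two drops remove the items of the
  -- variable itself.
  seqs [loop inp (fun a => decide (a = .blank)) fun _ => advance, drop vars, drop vars,
    emitSet (encodeItemset {slot s}) (encodeItemset {valueSlot b}) (1 / 6),
    pushes [(vars, .blank), (vars, .blank)], resetIdx]

/-- Continue with the sign of a literal. -/
def onSign (f : Bool → Cmd Tape Γ') : Γ' → Cmd Tape Γ'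
  | .bit b => f b
  | _ => nop

/-- Append the members of the family that belong to a clause, whose first literal has the sign
`b`. -/
def emitClause (b : Bool) : Cmd Tape Γ' :=
  seqs [seqs (List.replicate 6 (drop rest)),
    seqs (clausePatterns.map fun q => emitSet (encodeItemset q.1) [] q.2),
    emitLiteral b 0,
    pop inp fun o => o.elim nop (onSign fun b => emitLiteral b 1),
    pop inp fun o => o.elim nop (onSign fun b => emitLiteral b 2),
    pushes (List.replicate 6 (past, .blank))]

/-- The symbols that are pushed when a symbol of the clauses is read for the first time. -/
def scanSymbol (a : Γ') : List (Tape × Γ') :=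
  -- Each literal has one comma, so a clause contributes six items to `rest` and `101010` to the
  -- output.
  (tmp, a) :: if a = .comma then
    [(rest, .blank), (rest, .blank), (acc, .bit true), (acc, .bit false)] else []

/-- The program that writes the reversed output. -/
def build : Cmd Tape Γ' :=
  seqs [
    loop inp (fun a => decide (a = .blank)) fun _ => pushes [(vars, .blank), (vars, .blank)],
    loop inp (fun _ => true) fun a => pushes (scanSymbol a),
    loop tmp (fun _ => true) fun a => pushes [(inp, a)],
    emitZeros vars,
    emit (.comma :: encodeRat 0),
    emitSet [] [] 1,
    emitVars,
    loop inp (fun _ => true) (onSign emitClause),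
    loop past (fun _ => true) fun _ => pushes [],
    loop vars (fun _ => true) fun _ => pushes []]

/-- The program that computes the reduction. -/
def main : Cmd Tape Γ' := seq build (loop acc (fun _ => true) fun a => pushes [(out, a)])

/-- The stacks with the given contents; `w` is the output so far. -/
def tapes (i : List Γ') (n d r v : ℕ) (w : List Γ') : Tape → List Γ'
  | inp => i
  | vars => List.replicate n .blank
  | past => List.replicate d .blank
  | rest => List.replicate r .blank
  | tmp => []
  | idx => List.replicate v .blank
  | acc => w.reverse
  | out => []

/-! ### Effect and running time of the pieces of the program -/

variable {i : List Γ'} {n d r v : ℕ} {w : List Γ'}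

theorem flatMap_replicate_singleton {α β : Type*} (k : ℕ) (a : α) (b : β) :
    (List.replicate k a).flatMap (fun _ => [b]) = List.replicate k b := by
  induction k with
  | zero => rfl
  | succ k ih => rw [List.replicate_succ, List.flatMap_cons, ih]; rfl

theorem eval_emit (l : List Γ') :
    Eval (emit l) (tapes i n d r v w) (tapes i n d r v (w ++ l)) (l.length + 1) := by
  have h := eval_pushes (l.map fun a => (acc, a)) (tapes i n d r v w)
  have h2 : pushed (l.map fun a => (acc, a)) (tapes i n d r v w) = tapes i n d r v (w ++ l) := by
    funext t
    cases t <;> simp [pushed, tapes, List.filter_map, Function.comp_def]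
  rw [h2, List.length_map] at h
  exact h

theorem eval_emitZeros {c : Tape} (hc : c ≠ tmp) (hc' : c ≠ acc) {k : ℕ} {st : Tape → List Γ'}
    (hst : st c = List.replicate k .blank) (htmp : st tmp = []) :
    Eval (emitZeros c) st (Function.update st acc (zeros k ++ st acc)) (7 * k + 2) := by
  have h1 := eval_loop_pushes (s := c) (p := fun _ => true) (k := 2)
    (f := fun _ => [(tmp, Γ'.blank), (acc, Γ'.bit false)]) (by simp [hc.symm, hc'.symm]) (by simp)
    (l := List.replicate k .blank) (r := []) (by simp) (by simp) (st := st) (by simpa using hst)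
  have h2 := eval_loop_pushes (s := tmp) (p := fun _ => true) (k := 1)
    (f := fun _ => [(c, Γ'.blank)]) (by simp [hc]) (by simp)
    (l := List.replicate k .blank) (r := []) (by simp) (by simp)
    (st := pushed ((List.replicate k Γ'.blank).flatMap
      fun _ => [(tmp, Γ'.blank), (acc, Γ'.bit false)]) (Function.update st c [])) (by
        simp [pushed, List.filter_flatMap, hc.symm, htmp, flatMap_replicate_singleton])
  have h3 := (Eval.seq h1 h2).mono (u := 7 * k + 2) (by simp; omega)
  unfold emitZeros
  convert h3 using 1
  funext t
  by_cases h4 : t = c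
  · subst h4
    simp [pushed, List.filter_flatMap, List.map_flatMap, hc, hc', hc.symm, hc'.symm,
      flatMap_replicate_singleton, hst]
  by_cases h5 : t = acc
  · subst h5
    simp [pushed, List.filter_flatMap, hc', hc'.symm, flatMap_replicate_singleton, zeros]
  by_cases h6 : t = tmp
  · subst h6
    simp [pushed, List.filter_flatMap, List.map_flatMap, hc, htmp]
  · simp [pushed, List.flatMap_def, h4, h5, h6, Ne.symm h4, Ne.symm h5,
      Ne.symm h6]

theorem update_acc_tapes (k : ℕ) :
    Function.update (tapes i n d r v w) acc (zeros k ++ tapes i n d r v w acc) =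
      tapes i n d r v (w ++ zeros k) := by
  funext t
  cases t <;> simp [tapes, zeros]

theorem eval_emitZeros_vars : Eval (emitZeros vars) (tapes i n d r v w)
    (tapes i n d r v (w ++ zeros n)) (7 * n + 2) :=
  update_acc_tapes n ▸ eval_emitZeros (by simp) (by simp) rfl rfl

theorem eval_emitZeros_past : Eval (emitZeros past) (tapes i n d r v w)
    (tapes i n d r v (w ++ zeros d)) (7 * d + 2) :=
  update_acc_tapes d ▸ eval_emitZeros (by simp) (by simp) rfl rfl

theorem eval_emitZeros_rest : Eval (emitZeros rest) (tapes i n d r v w)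
    (tapes i n d r v (w ++ zeros r)) (7 * r + 2) :=
  update_acc_tapes r ▸ eval_emitZeros (by simp) (by simp) rfl rfl

theorem eval_emitZeros_idx : Eval (emitZeros idx) (tapes i n d r v w)
    (tapes i n d r v (w ++ zeros v)) (7 * v + 2) :=
  update_acc_tapes v ▸ eval_emitZeros (by simp) (by simp) rfl rfl

theorem eval_emitSet {P Q : List Γ'} {x : ℚ} (hP : P.length ≤ 6) (hQ : Q.length ≤ 2)
    (hx : x ∈ [0, 1, 1 / 2, 1 / 6]) :
    Eval (emitSet P Q x) (tapes i n d r v w) (tapes i n d r v (w ++ setWord d P r v Q n x))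
      (7 * (d + r + v + n) + 31) := by
  have h := Eval.seq (eval_emitZeros_past (i := i) (n := n) (d := d) (r := r) (v := v) (w := w))
    (.seq (eval_emit P) (.seq eval_emitZeros_rest (.seq eval_emitZeros_idx (.seq (eval_emit Q)
      (.seq eval_emitZeros_vars (.seq (eval_emit (.comma :: encodeRat x)) (.nop _)))))))
  have hx' := length_encodeRat_le hx
  rw [show w ++ setWord d P r v Q n x = w ++ zeros d ++ P ++ zeros r ++ zeros v ++ Q ++ zeros n ++
    Γ'.comma :: encodeRat x by simp [setWord]]
  -- The constant 31 is 4 · 2 for the counters, 7 and 3 for `P` and `Q`, 12 for the rational with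
  -- its comma and 1 for the final `nop`.
  refine h.mono ?_
  rw [List.length_cons]
  omega

theorem update_inp_tapes (i' : List Γ') :
    Function.update (tapes i n d r v w) inp i' = tapes i' n d r v w := by
  funext t; cases t <;> simp [tapes]

theorem update_vars_tapes (k : ℕ) :
    Function.update (tapes i n d r v w) vars (List.replicate k .blank) = tapes i k d r v w := by
  funext t; cases t <;> simp [tapes]

theorem update_rest_tapes (k : ℕ) :
    Function.update (tapes i n d r v w) rest (List.replicate k .blank) = tapes i n d k v w := by
  funext t; cases t <;> simp [tapes]

theorem eval_drop_vars :
    Eval (drop vars) (tapes i (n + 1) d r v w) (tapes i n d r v w) 2 := by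
  rw [← update_vars_tapes (n := n + 1) n]
  exact eval_drop (a := Γ'.blank) (by simp [tapes, List.replicate_succ])

theorem eval_drops_rest (k : ℕ) : Eval (seqs (List.replicate k (drop rest)))
    (tapes i n d (r + k) v w) (tapes i n d r v w) (2 * k + 1) := by
  induction k with
  | zero => exact .nop _
  | succ k ih =>
    have : Eval (drop rest) (tapes i n d (r + (k + 1)) v w) (tapes i n d (r + k) v w) 2 := by
      rw [← update_rest_tapes (r := r + (k + 1)) (r + k)]
      exact eval_drop (a := Γ'.blank) (by simp [tapes, ← add_assoc, List.replicate_succ])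
    exact (Eval.seq this ih).mono (by omega)

theorem eval_push_two_idx : Eval (pushes [(idx, Γ'.blank), (idx, Γ'.blank)])
    (tapes i n d r v w) (tapes i n d r (v + 2) w) 3 := by
  have h := eval_pushes [(idx, Γ'.blank), (idx, Γ'.blank)] (tapes i n d r v w)
  have h2 : pushed [(idx, Γ'.blank), (idx, Γ'.blank)] (tapes i n d r v w) =
      tapes i n d r (v + 2) w := by
    funext t; cases t <;> simp [pushed, tapes, List.replicate_succ]
  rwa [h2] at h

theorem eval_push_two_vars : Eval (pushes [(vars, Γ'.blank), (vars, Γ'.blank)])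
    (tapes i n d r v w) (tapes i (n + 2) d r v w) 3 := by
  have h := eval_pushes [(vars, Γ'.blank), (vars, Γ'.blank)] (tapes i n d r v w)
  have h2 : pushed [(vars, Γ'.blank), (vars, Γ'.blank)] (tapes i n d r v w) =
      tapes i (n + 2) d r v w := by
    funext t; cases t <;> simp [pushed, tapes, List.replicate_succ]
  rwa [h2] at h

theorem eval_push_six_past : Eval (pushes (List.replicate 6 (past, Γ'.blank)))
    (tapes i n d r v w) (tapes i n (d + 6) r v w) 7 := by
  have h := eval_pushes (List.replicate 6 (past, Γ'.blank)) (tapes i n d r v w)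
  have h2 : pushed (List.replicate 6 (past, Γ'.blank)) (tapes i n d r v w) =
      tapes i n (d + 6) r v w := by
    funext t; cases t <;> simp [pushed, tapes, List.replicate_succ]
  rwa [h2] at h

theorem eval_advance :
    Eval advance (tapes i (n + 2) d r v w) (tapes i n d r (v + 2) w) 8 :=
  .seq eval_drop_vars (.seq eval_drop_vars (.seq eval_push_two_idx (.nop _)))

theorem eval_resetIdx :
    Eval resetIdx (tapes i n d r v w) (tapes i (n + v) d r 0 w) (3 * v + 1) := by
  have h := eval_loop_pushes (s := idx) (p := fun _ => true) (k := 1)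
    (f := fun _ => [(vars, Γ'.blank)]) (by simp) (by simp)
    (l := List.replicate v .blank) (r := []) (by simp) (by simp) (st := tapes i n d r v w)
    (by simp [tapes])
  rw [List.length_replicate] at h
  unfold resetIdx
  convert h using 1
  funext t
  cases t <;> simp [pushed, tapes, List.flatMap_def, add_comm n]

/-- A bound for the number of steps that an itemset takes, where `K` is the number of items. -/
def setTime (K : ℕ) : ℕ := 7 * K + 31

theorem eval_emitSet_le {P Q : List Γ'} {x : ℚ} {K : ℕ} (hP : P.length ≤ 6) (hQ : Q.length ≤ 2)
    (hx : x ∈ [0, 1, 1 / 2, 1 / 6]) (hK : d + r + v + n ≤ K) :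
    Eval (emitSet P Q x) (tapes i n d r v w) (tapes i n d r v (w ++ setWord d P r v Q n x))
      (setTime K) :=
  (eval_emitSet hP hQ hx).mono (by unfold setTime; omega)

theorem length_encodeItemset {k : ℕ} (s : Finset (Fin k)) : (encodeItemset s).length = k := by
  simp [encodeItemset]

/-- Induction on the number `k` of remaining variables: `idx` and `vars` hold two symbols for each
processed and each remaining variable. -/
theorem eval_loop_vars {N m : ℕ} (k : ℕ) (hk : v + k = N) :
    Eval (loop vars (fun _ => true) fun _ => seqs [drop vars,
        seqs (varPatterns.map fun q => emitSet [] (encodeItemset q.1) q.2),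
        pushes [(idx, .blank), (idx, .blank)]])
      (tapes i (k * 2) 0 (m * 6) (v * 2) w)
      (tapes i 0 0 (m * 6) (N * 2) (w ++ (List.range' v k).flatMap (varWord N m)))
      ((3 * setTime (m * 6 + N * 2) + 8) * k + 1) := by
  induction k generalizing v w with
  | zero =>
    obtain rfl : v = N := by omega
    simpa using Eval.loop_nil (by simp [tapes])
  | succ k ih =>
    have hset : ∀ q ∈ varPatterns, ∀ w', Eval (emitSet [] (encodeItemset q.1) q.2)
        (tapes i (k * 2) 0 (m * 6) (v * 2) w') (tapes i (k * 2) 0 (m * 6) (v * 2)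
          (w' ++ setWord 0 [] (m * 6) (v * 2) (encodeItemset q.1) ((N - 1 - v) * 2) q.2))
        (setTime (m * 6 + N * 2)) := by
      intro q hq w'
      rw [show N - 1 - v = k by omega]
      refine eval_emitSet_le (by simp) (by rw [length_encodeItemset]) ?_ (by omega)
      simp only [varPatterns, List.mem_cons, List.not_mem_nil, or_false] at hq
      rcases hq with rfl | rfl | rfl <;> simp
    have hbody := Eval.seq (eval_drop_vars (i := i) (n := k * 2) (d := 0) (r := m * 6) (v := v * 2)
      (w := w)) (.seq (eval_seqs_map hset w) (.seq eval_push_two_idx (.nop _)))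
    have hrest := ih (v := v + 1) (w := w ++ varWord N m v) (by omega)
    rw [List.range'_succ, List.flatMap_cons, ← List.append_assoc]
    rw [show (v + 1) * 2 = v * 2 + 2 by ring] at hrest
    rw [← update_vars_tapes (n := (k + 1) * 2)] at hbody
    refine (Eval.loop_step (a := .blank) ?_ rfl hbody hrest).mono ?_
    · simp [tapes, Nat.succ_mul, List.replicate_succ]
    · rw [Nat.mul_succ _ k, show varPatterns.length = 3 from rfl]
      omega

theorem eval_emitVars {N m : ℕ} :
    Eval emitVars (tapes i (N * 2) 0 (m * 6) 0 w)
      (tapes i (N * 2) 0 (m * 6) 0 (w ++ (List.range' 0 N).flatMap (varWord N m)))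
      ((3 * setTime (m * 6 + N * 2) + 8) * N + 6 * N + 2) := by
  have h := eval_loop_vars (i := i) (w := w) (m := m) (N := N) (v := 0) N (Nat.zero_add N)
  have h2 := Eval.seq h eval_resetIdx
  rw [Nat.zero_mul, Nat.zero_add] at h2
  exact h2.mono (by omega)

theorem eval_loop_advance (u : ℕ) :
    Eval (loop inp (fun a => decide (a = Γ'.blank)) fun _ => advance)
      (tapes (List.replicate u .blank ++ .comma :: i) (n + u * 2) d r v w)
      (tapes i n d r (v + u * 2) w) (9 * u + 1) := by
  induction u generalizing v with
  | zero =>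
    have := Eval.loop_exit (st := tapes (.comma :: i) n d r v w) (s := inp) (a := Γ'.comma) (l := i)
      (p := fun a => decide (a = Γ'.blank)) (body := fun _ => advance) rfl rfl
    rw [update_inp_tapes] at this
    simpa using this
  | succ u ih =>
    have h1 := eval_advance (i := List.replicate u Γ'.blank ++ Γ'.comma :: i) (n := n + u * 2) (d := d)
      (r := r) (v := v) (w := w)
    have h2 := ih (v := v + 2)
    rw [← update_inp_tapes (i := List.replicate (u + 1) Γ'.blank ++ Γ'.comma :: i)] at h1
    rw [show v + (u + 1) * 2 = v + 2 + u * 2 by ring, show n + (u + 1) * 2 = n + u * 2 + 2 by ring]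
    refine (Eval.loop_step (s := inp) (p := fun a => decide (a = Γ'.blank))
      (body := fun _ => advance) (a := Γ'.blank) ?_ rfl h1 h2).mono (by omega)
    rfl

theorem eval_emitLiteral {N K : ℕ} (l : Literal N) (s : Fin 3) (hK : d + r + N * 2 ≤ K) :
    Eval (emitLiteral l.2 s) (tapes (List.replicate l.1 .blank ++ .comma :: i) (N * 2) d r 0 w)
      (tapes i (N * 2) d r 0 (w ++ setWord d (encodeItemset {slot s}) r (l.1 * 2)
        (encodeItemset {valueSlot l.2}) ((N - 1 - l.1) * 2) (1 / 6)))
      (setTime K + 15 * N + 10) := by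
  obtain ⟨⟨u, hu⟩, b⟩ := l
  -- `u` variables come before that of the literal and `k` after it.
  obtain ⟨k, rfl⟩ : ∃ k, N = k + 1 + u := ⟨N - 1 - u, by omega⟩
  have h := Eval.seq (eval_loop_advance (i := i) (n := k * 2 + 1 + 1) (d := d) (r := r) (v := 0)
    (w := w) u) (.seq eval_drop_vars (.seq eval_drop_vars (.seq
      (eval_emitSet_le (K := K) (P := encodeItemset {slot s}) (Q := encodeItemset {valueSlot b})
        (x := 1 / 6) (by rw [length_encodeItemset]) (by rw [length_encodeItemset]) (by simp)
        (by omega)) (.seq eval_push_two_vars (.seq eval_resetIdx (.nop _))))))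
  rw [show k * 2 + 1 + 1 + u * 2 = (k + 1 + u) * 2 by ring,
    show k * 2 + 2 + (0 + u * 2) = (k + 1 + u) * 2 by ring, Nat.zero_add] at h
  dsimp only
  rw [show k + 1 + u - 1 - u = k by omega]
  exact h.mono (by omega)

theorem eval_pop_emitLiteral {N K : ℕ} (l : Literal N) (s : Fin 3) (hK : d + r + N * 2 ≤ K) :
    Eval (pop inp fun o => o.elim nop (onSign fun b => emitLiteral b s))
      (tapes (encodeLiteral l ++ i) (N * 2) d r 0 w)
      (tapes i (N * 2) d r 0 (w ++ setWord d (encodeItemset {slot s}) r (l.1 * 2)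
        (encodeItemset {valueSlot l.2}) ((N - 1 - l.1) * 2) (1 / 6)))
      (setTime K + 15 * N + 11) := by
  have h := eval_emitLiteral (i := i) (w := w) l s hK
  rw [← update_inp_tapes (i := encodeLiteral l ++ i)] at h
  refine Eval.pop (s := inp) (t := setTime K + 15 * N + 10) ?_
  simpa [tapes, encodeLiteral, onSign] using h

/-- The sign of the first literal is already popped by the loop over the clauses. The 13 itemsets
are ten patterns and three links. -/
theorem eval_emitClause {N m j : ℕ} (c : Literal N × Literal N × Literal N) (hj : j < m) :
    Eval (emitClause c.1.2)
      (tapes (List.replicate c.1.1 .blank ++ .comma :: (encodeLiteral c.2.1 ++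
        (encodeLiteral c.2.2 ++ i))) (N * 2) (j * 6) ((m - j) * 6) 0 w)
      (tapes i (N * 2) ((j + 1) * 6) ((m - (j + 1)) * 6) 0 (w ++ clauseWord m c j))
      (13 * setTime (m * 6 + N * 2) + 45 * N + 60) := by
  have hset : ∀ i, ∀ q ∈ clausePatterns, ∀ w', Eval (emitSet (encodeItemset q.1) [] q.2)
      (tapes i (N * 2) (j * 6) ((m - 1 - j) * 6) 0 w') (tapes i (N * 2) (j * 6) ((m - 1 - j) * 6) 0
        (w' ++ setWord (j * 6) (encodeItemset q.1) ((m - 1 - j) * 6) 0 [] (N * 2) q.2))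
      (setTime (m * 6 + N * 2)) := by
    intro i q hq w'
    refine eval_emitSet_le (by rw [length_encodeItemset]) (by simp) ?_ (by omega)
    have : ∀ q ∈ clausePatterns, q.2 ∈ [0, 1, 1 / 2, 1 / 6] := by simp [clausePatterns]
    exact this q hq
  have hK : j * 6 + (m - 1 - j) * 6 + N * 2 ≤ m * 6 + N * 2 := by omega
  have h := Eval.seq (eval_drops_rest (r := (m - 1 - j) * 6) (d := j * 6) (v := 0) (w := w) 6)
    (.seq (eval_seqs_map (hset _) w) (.seq (eval_emitLiteral c.1 0 hK)
      (.seq (eval_pop_emitLiteral c.2.1 1 hK) (.seq (eval_pop_emitLiteral (i := i) c.2.2 2 hK)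
        (.seq eval_push_six_past (.nop _))))))
  rw [show (m - 1 - j) * 6 + 6 = (m - j) * 6 by omega, show j * 6 + 6 = (j + 1) * 6 by ring,
    show m - 1 - j = m - (j + 1) by omega] at h
  rw [show w ++ clauseWord m c j = _ from ?_]
  · refine h.mono ?_
    rw [show clausePatterns.length = 10 from rfl]
    omega
  · simp [clauseWord, literalAt, show m - 1 - j = m - (j + 1) by omega]

/-- Invariant: `past` and `rest` hold six symbols for each processed and each remaining clause. -/
theorem eval_loop_clauses {N m j : ℕ} (cs : List (Literal N × Literal N × Literal N))
    (hj : j + cs.length = m) :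
    Eval (loop inp (fun _ => true) (onSign emitClause))
      (tapes (cs.flatMap encodeClause) (N * 2) (j * 6) ((m - j) * 6) 0 w)
      (tapes [] (N * 2) (m * 6) 0 0 (w ++ (cs.zipIdx j).flatMap fun x => clauseWord m x.1 x.2))
      ((13 * setTime (m * 6 + N * 2) + 45 * N + 61) * cs.length + 1) := by
  induction cs generalizing j w with
  | nil =>
    obtain rfl : j = m := by simpa using hj
    simpa using Eval.loop_nil (by simp [tapes])
  | cons c cs ih =>
    rw [List.length_cons] at hj
    have h1 := eval_emitClause (i := cs.flatMap encodeClause) (w := w) (m := m) (j := j) c (by omega)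
    have h2 := ih (j := j + 1) (w := w ++ clauseWord m c j) (by omega)
    rw [← update_inp_tapes (i := (c :: cs).flatMap encodeClause)] at h1
    rw [show w ++ ((c :: cs).zipIdx j).flatMap (fun x => clauseWord m x.1 x.2) =
      w ++ clauseWord m c j ++ (cs.zipIdx (j + 1)).flatMap fun x => clauseWord m x.1 x.2 by
        simp [List.zipIdx_cons]]
    refine (Eval.loop_step (a := .bit c.1.2) ?_ rfl h1 h2).mono ?_
    · simp [tapes, encodeClause, encodeLiteral]
    · rw [List.length_cons, Nat.mul_succ _ cs.length]
      omega

/-! ### Scanning the input and the total running time -/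

theorem flatten_replicate_pair {α : Type*} (k : ℕ) (a : α) :
    (List.replicate k [a, a]).flatten = List.replicate (k * 2) a := by
  rw [show [a, a] = List.replicate 2 a from rfl, List.flatten_replicate_replicate]

theorem eval_readVars (N : ℕ) :
    Eval (loop inp (fun a => decide (a = Γ'.blank)) fun _ =>
        pushes [(vars, Γ'.blank), (vars, Γ'.blank)])
      (tapes (List.replicate N .blank ++ .comma :: i) 0 d r v w) (tapes i (N * 2) d r v w)
      (4 * N + 1) := by
  have h := eval_loop_pushes (s := inp) (p := fun a => decide (a = Γ'.blank)) (k := 2)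
    (f := fun _ => [(vars, Γ'.blank), (vars, Γ'.blank)]) (by simp) (by simp)
    (l := List.replicate N .blank) (r := .comma :: i) (by simp) (by simp)
    (st := tapes (List.replicate N .blank ++ .comma :: i) 0 d r v w) rfl
  rw [List.length_replicate, List.tail_cons, update_inp_tapes] at h
  convert h using 1
  funext t
  cases t <;> simp [pushed, tapes, List.flatMap_def, flatten_replicate_pair]

/-- The symbols that are pushed on the stack `t`. -/
def pushedOn (t : Tape) (L : List (Tape × Γ')) : List Γ' :=
  (L.filter fun x => x.1 = t).map Prod.snd

theorem pushedOn_append (t : Tape) (L M : List (Tape × Γ')) :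
    pushedOn t (L ++ M) = pushedOn t L ++ pushedOn t M := by
  simp [pushedOn]

theorem pushedOn_tmp_scan (l : List Γ') : pushedOn tmp (l.flatMap scanSymbol) = l := by
  induction l with
  | nil => rfl
  | cons a l ih =>
    rw [List.flatMap_cons, pushedOn_append, ih]
    by_cases h : a = .comma <;> simp [pushedOn, scanSymbol, h]

theorem pushedOn_scan_of_ne {t : Tape} (h₁ : t ≠ tmp) (h₂ : t ≠ rest) (h₃ : t ≠ acc) (l : List Γ') :
    pushedOn t (l.flatMap scanSymbol) = [] := by
  induction l with
  | nil => rfl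
  | cons a l ih =>
    rw [List.flatMap_cons, pushedOn_append, ih]
    by_cases h : a = .comma <;> simp [pushedOn, scanSymbol, h, h₁.symm, h₂.symm, h₃.symm]

/-- Outside `tmp` only the comma has an effect, and a literal contains exactly one. -/
theorem pushedOn_scan_literal {t : Tape} (ht : t ≠ tmp) {N : ℕ} (l : Literal N) :
    pushedOn t ((encodeLiteral l).flatMap scanSymbol) = pushedOn t (scanSymbol .comma) := by
  have : ∀ k, pushedOn t ((List.replicate k Γ'.blank).flatMap scanSymbol) = [] := by
    intro k
    induction k with
    | zero => rfl
    | succ k ih =>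
      rw [List.replicate_succ, List.flatMap_cons, pushedOn_append, ih]
      simp [pushedOn, scanSymbol, ht.symm]
  rw [encodeLiteral, List.cons_append, List.flatMap_cons, List.flatMap_append, pushedOn_append,
    pushedOn_append, this]
  simp [pushedOn, scanSymbol, ht.symm]

theorem pushedOn_scan_clauses {t : Tape} (ht : t ≠ tmp) {N : ℕ}
    (cs : List (Literal N × Literal N × Literal N)) :
    pushedOn t ((cs.flatMap encodeClause).flatMap scanSymbol) =
      (List.replicate (cs.length * 3) (pushedOn t (scanSymbol .comma))).flatten := by
  induction cs with
  | nil => rfl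
  | cons c cs ih =>
    rw [List.flatMap_cons, List.flatMap_append, pushedOn_append, ih, encodeClause,
      List.flatMap_append, List.flatMap_append, pushedOn_append, pushedOn_append,
      pushedOn_scan_literal ht, pushedOn_scan_literal ht, pushedOn_scan_literal ht,
      List.length_cons, Nat.succ_mul, Nat.add_comm, List.replicate_add, List.flatten_append]
    simp [List.replicate_succ]

theorem eval_scan {N : ℕ} (cs : List (Literal N × Literal N × Literal N)) :
    Eval (loop inp (fun _ => true) fun a => pushes (scanSymbol a))
      (tapes (cs.flatMap encodeClause) n 0 0 0 [])
      (Function.update (tapes [] n 0 (cs.length * 6) 0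
        (List.replicate (cs.length * 3) [Γ'.bit true, Γ'.bit false]).flatten) tmp
        (cs.flatMap encodeClause).reverse) (7 * (cs.flatMap encodeClause).length + 1) := by
  have h := eval_loop_pushes (s := inp) (p := fun _ => true) (k := 5) (f := scanSymbol)
    (by intro a; by_cases h : a = .comma <;> simp [scanSymbol, h])
    (by intro a; by_cases h : a = .comma <;> simp [scanSymbol, h])
    (l := cs.flatMap encodeClause) (r := []) (by simp) (by simp)
    (st := tapes (cs.flatMap encodeClause) n 0 0 0 []) (by simp [tapes])
  convert h using 1
  funext t
  rw [pushed]
  change _ = (pushedOn t _).reverse ++ _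
  rcases eq_or_ne t tmp with rfl | h1
  · rw [pushedOn_tmp_scan]
    simp [tapes]
  rcases eq_or_ne t acc with rfl | h2
  · rw [pushedOn_scan_clauses h1]
    simp [tapes, pushedOn, scanSymbol]
  rcases eq_or_ne t rest with rfl | h3
  · rw [pushedOn_scan_clauses h1]
    simp [tapes, pushedOn, scanSymbol, flatten_replicate_pair, Nat.mul_assoc]
  · rw [pushedOn_scan_of_ne h1 h3 h2]
    cases t <;> simp_all [tapes]

theorem eval_restore {l : List Γ'} :
    Eval (loop tmp (fun _ => true) fun a => pushes [(inp, a)])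
      (Function.update (tapes [] n d r v w) tmp l.reverse) (tapes l n d r v w)
      (3 * l.length + 1) := by
  have h := eval_loop_pushes (s := tmp) (p := fun _ => true) (k := 1)
    (f := fun a => [(inp, a)]) (by simp) (by simp) (l := l.reverse) (r := []) (by simp) (by simp)
    (st := Function.update (tapes [] n d r v w) tmp l.reverse) (by simp)
  rw [List.length_reverse] at h
  convert h using 1
  have : ∀ (t : Tape) (m : List Γ'), (((m.flatMap fun a => [(inp, a)]).filter
      fun x => x.1 = t).map Prod.snd) = if t = inp then m else [] := by
    intro t m
    induction m with
    | nil => simp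
    | cons a m ih =>
      rw [List.flatMap_cons, List.filter_append, List.map_append, ih]
      split_ifs with ht
      · simp [ht]
      · simp [Ne.symm ht]
  funext t
  rw [pushed, this]
  cases t <;> simp [tapes]

theorem eval_clear_past : Eval (loop past (fun _ => true) fun _ => pushes [])
    (tapes i n d r v w) (tapes i n 0 r v w) (2 * d + 1) := by
  have h := eval_loop_pushes (s := past) (p := fun _ => true) (k := 0)
    (f := fun _ : Γ' => []) (by simp) (by simp) (l := List.replicate d .blank) (r := [])
    (by simp) (by simp) (st := tapes i n d r v w) (by simp [tapes])
  rw [List.length_replicate] at h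
  convert h using 1
  funext t
  cases t <;> simp [pushed, tapes]

theorem eval_clear_vars : Eval (loop vars (fun _ => true) fun _ => pushes [])
    (tapes i n d r v w) (tapes i 0 d r v w) (2 * n + 1) := by
  have h := eval_loop_pushes (s := vars) (p := fun _ => true) (k := 0)
    (f := fun _ : Γ' => []) (by simp) (by simp) (l := List.replicate n .blank) (r := [])
    (by simp) (by simp) (st := tapes i n d r v w) (by simp [tapes])
  rw [List.length_replicate] at h
  convert h using 1
  funext t
  cases t <;> simp [pushed, tapes]

theorem eval_output : Eval (loop acc (fun _ => true) fun a => pushes [(out, a)])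
    (tapes [] 0 0 0 0 w) (Function.update (fun _ => []) out w) (3 * w.length + 1) := by
  have h := eval_loop_pushes (s := acc) (p := fun _ => true) (k := 1)
    (f := fun a => [(out, a)]) (by simp) (by simp) (l := w.reverse) (r := []) (by simp) (by simp)
    (st := tapes [] 0 0 0 0 w) (by simp [tapes])
  rw [List.length_reverse] at h
  convert h using 1
  have : ∀ (t : Tape) (m : List Γ'), (((m.flatMap fun a => [(out, a)]).filter
      fun x => x.1 = t).map Prod.snd) = if t = out then m else [] := by
    intro t m
    induction m with
    | nil => simp
    | cons a m ih =>
      rw [List.flatMap_cons, List.filter_append, List.map_append, ih]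
      split_ifs with ht
      · simp [ht]
      · simp [Ne.symm ht]
  funext t
  rw [pushed, this]
  cases t <;> simp [tapes]

/-- Each literal takes at least a sign and a comma, so a clause has at least six symbols and the
number of items is linear in the input length. -/
theorem length_encode_ge (φ : ThreeCNF) :
    φ.numVars + (φ.clauses.flatMap encodeClause).length + 1 = φ.encode.length ∧
      6 * φ.clauses.length ≤ (φ.clauses.flatMap encodeClause).length := by
  constructor
  · simp [ThreeCNF.encode]; omega
  · induction φ.clauses with
    | nil => simp
    | cons c cs ih =>
      rw [List.flatMap_cons, List.length_append, List.length_cons]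
      have : 6 ≤ (encodeClause c).length := by
        simp [encodeClause, encodeLiteral]
        omega
      omega

theorem eval_build (φ : ThreeCNF) :
    Eval build (tapes φ.encode 0 0 0 0 []) (tapes [] 0 0 0 0 φ.instanceOf.encode)
      (1000 * (φ.encode.length + 1) ^ 2) := by
  obtain ⟨N, cs⟩ := φ
  obtain ⟨hl₁, hl₂⟩ := length_encode_ge ⟨N, cs⟩
  have hout := encode_instanceOf ⟨N, cs⟩
  have hcs := eval_loop_clauses (j := 0) (m := cs.length) (w := queryWord cs.length N ++
    Γ'.comma :: encodeRat 0 ++ setWord 0 [] (cs.length * 6) 0 [] (N * 2) 1 ++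
      (List.range' 0 N).flatMap (varWord N cs.length)) cs (Nat.zero_add _)
  rw [Nat.zero_mul, Nat.sub_zero] at hcs
  have h := Eval.seq (eval_readVars (d := 0) (r := 0) (v := 0) (w := []) N)
    (.seq (eval_scan cs) (.seq eval_restore (.seq eval_emitZeros_vars
      (.seq (eval_emit (.comma :: encodeRat 0)) (.seq (eval_emitSet_le (K := cs.length * 6 + N * 2)
        (P := []) (Q := []) (x := 1) (by simp) (by simp) (by simp) (by omega))
        (.seq eval_emitVars (.seq hcs (.seq eval_clear_past (.seq eval_clear_vars (.nop _))))))))))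
  rw [hout]
  refine h.mono ?_
  have hr := length_encodeRat_le (x := 0) (by simp)
  dsimp only at hl₁ hl₂
  rw [List.length_cons]
  generalize (ThreeCNF.encode ⟨N, cs⟩).length = ℓ at *
  generalize (encodeRat 0).length = ρ at *
  generalize (cs.flatMap encodeClause).length = I at *
  generalize cs.length = m at *
  -- There are at most `2 * ℓ` items, and `7 * (2 * ℓ) + 31 ≤ 31 * (ℓ + 1)`.
  have hT : setTime (m * 6 + N * 2) ≤ 31 * (ℓ + 1) := by unfold setTime; omega
  generalize setTime (m * 6 + N * 2) = T at *
  have h1 : (3 * T + 8) * N ≤ 101 * (ℓ + 1) * (ℓ + 1) := Nat.mul_le_mul (by omega) (by omega)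
  have h2 : (13 * T + 45 * N + 61) * m ≤ 509 * (ℓ + 1) * (ℓ + 1) :=
    Nat.mul_le_mul (by omega) (by omega)
  have h3 : ℓ + 1 ≤ (ℓ + 1) * (ℓ + 1) := Nat.le_mul_self _
  rw [pow_two]
  rw [Nat.mul_assoc] at h1 h2
  -- With the square as an atom the bound is linear.
  generalize (ℓ + 1) * (ℓ + 1) = S at *
  omega

theorem eval_main (φ : ThreeCNF) :
    Eval main (Function.update (fun _ => []) inp φ.encode)
      (Function.update (fun _ => []) out φ.instanceOf.encode)
      (5000 * (φ.encode.length + 1) ^ 2) := by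
  have h : Function.update (fun _ => []) inp φ.encode = tapes φ.encode 0 0 0 0 [] := by
    funext t; cases t <;> simp [tapes]
  -- The output is no longer than the time spent writing it, so reversing it costs at most three
  -- times as much, plus one.
  have hlen := (eval_build φ).length_le acc
  simp only [tapes, List.length_reverse, List.length_nil, Nat.zero_add] at hlen
  rw [h]
  refine (Eval.seq (eval_build φ) eval_output).mono ?_
  have : 0 < (φ.encode.length + 1) ^ 2 := by positivity
  omega

end Program

end ItemsetQuery

theorem theorem4 :
    ItemsetQuery.PolyTimeReducible ItemsetQuery.ThreeSAT ItemsetQuery.EntrQueryDec := by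
  open ItemsetQuery in
  refine ⟨ThreeCNF.instanceOf, ?_, fun φ => ThreeCNF.satisfiable_iff_instanceOf_mem_yes⟩
  refine Cmd.computableInPolyTime (ea := ThreeCNF.encode) (eb := EntrQueryInstance.encode)
    (f := ThreeCNF.instanceOf) Program.main .inp .out (5000 * (Polynomial.X + 1) ^ 2) fun φ => ?_
  simpa using Program.eval_main φ
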